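/- Let $\mathfrak n$ be a finite-dimensional real 2-step nilpotent Lie algebra with an inner product $\langle\,,\rangle$ (a nondegenerate symmetric bilinear form, possibly indefinite) whose restriction to the center $\mathfrak z$ is nondegenerate, and let $\mathfrak v=\mathfrak z^\perp$. Let $N$ be the connected, simply connected Lie group with Lie algebra $\mathfrak n$, with the induced left-invariant pseudoriemannian metric; in exponential coordinates $N=\mathfrak n$ with product $p\cdot q=p+q+\frac12[p,q]$ and identity $0$. For $z\in\mathfrak z$ let $J_z\in\operatorname{End}(\mathfrak v)$ be given by $\langle J_zx,y\rangle=\langle z,[x,y]\rangle$ for all $y\in\mathfrak n$. The point $\gamma(t)$, $t\neq0$, is conjugate to $\gamma(0)$ along a geodesic $\gamma$ if there is a Jacobi field $Y\not\equiv0$ along $\gamma$ with $Y(0)=Y(t)=0$. Assume that $\dim\mathfrak z=1$ and that $J_z^2$ is diagonalizable over $\mathbb R$ for all $z\in\mathfrak z$ (equivalently, for one nonzero $z$). 1. For $0\neq z\in\mathfrak z$ all eigenvalues of $J_z^2$ are nonzero. If the distinct ones are $-\lambda_1^2,\dots,-\lambda_q^2$ and $\lambda_{q+1}^2,\dots,\lambda_m^2$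 with all $\lambda_j>0$, then $\mathfrak v$ is the orthogonal direct sum of the corresponding eigenspaces $\mathfrak w_1,\dots,\mathfrak w_m$ of $J_z^2$, and each $\mathfrak w_j$ is $J_z$-invariant. So each $x_0\in\mathfrak v$ has components $A_k\in\mathfrak w_k$ $(1\le k\le q)$ and $B_{q+l}\in\mathfrak w_{q+l}$ $(1\le l\le m-q)$ with $x_0=\sum_kA_k+\sum_lB_{q+l}$. Now let $\gamma$ be the geodesic with $\gamma(0)=1\in N$ and $\dot\gamma(0)=z_0+x_0$, where $z_0\in\mathfrak z$, $x_0\in\mathfrak v$, and let $t\neq0$ be real. 2. If $z_0=0$ and $x_0\neq0$, let $z\in\mathfrak z$ be a unit vector, $\varepsilon=\langle z,z\rangle=\pm1$, and take $\lambda_j,A_k,B_{q+l}$ with respect to $J_z^2$. Then $\gamma(t)$ is conjugate to $\gamma(0)$ along $\gamma$ if and only if $$\frac{12}{t^2}=\sum_{l=1}^{m-q}\lambda_{q+l}^2\,\varepsilon\langle B_{q+l},B_{q+l}\rangle-\sum_{k=1}^q\lambda_k^2\,\varepsilon\langle A_k,A_k\rangle .$$ 3. If $z_0\neq0$ and $x_0\neq0$,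 take $\lambda_j,A_k,B_{q+l}$ with respect to $J_{z_0}^2$. Then $\gamma(t)$ is conjugate to $\gamma(0)$ along $\gamma$ if and only if either $t=\frac{2\pi}{\lambda_k}n$ for some $1\le k\le q$ and some nonzero integer $n$, or $$\sum_{k=1}^q\langle A_k,A_k\rangle\frac{\lambda_kt}{2}\cot\frac{\lambda_kt}{2}+\sum_{l=1}^{m-q}\langle B_{q+l},B_{q+l}\rangle\frac{\lambda_{q+l}t}{2}\coth\frac{\lambda_{q+l}t}{2}=\langle\dot\gamma,\dot\gamma\rangle .$$ -/

import Mathlib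

noncomputable section

/-! ### Pseudo-Riemannian geometry in a global linear chart

A pseudo-Riemannian metric on a finite-dimensional real vector space `E`, regarded as a manifold with
one global chart, is a field `g : E → E → E → ℝ`, where `g p u w` is the inner product of the tangent
vectors `u`, `w` at the point `p`. -/

namespace PseudoRiem

variable {E : Type*} [AddCommGroup E] [Module ℝ E] [TopologicalSpace E]

/-- Derivative at `p` in the direction `u` of a function on `E`. -/
def dirDeriv {F : Type*} [AddCommGroup F] [Module ℝ F] [TopologicalSpace F]
    (f : E → F) (p u : E) : F :=
  deriv (fun s : ℝ => f (p + s • u)) 0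

/-- `c` is the vector `Γ_p(u, w)` of the Levi-Civita connection of `g`:
`g(Γ(u, w), v) = (∂_u g(w, v) + ∂_w g(u, v) - ∂_v g(u, w)) / 2` for every `v`. -/
def IsChristoffel (g : E → E → E → ℝ) (p u w c : E) : Prop :=
  ∀ v : E, g p c v =
    (dirDeriv (fun q => g q w v) p u + dirDeriv (fun q => g q u v) p w
      - dirDeriv (fun q => g q u w) p v) / 2

/-- The Christoffel map `Γ_p(u, w)` of the metric `g` (for a nondegenerate `g` it is the only vector
that satisfies the defining equation). -/
def christoffel (g : E → E → E → ℝ) (p u w : E) : E :=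
  Classical.epsilon (IsChristoffel g p u w)

/-- The curvature tensor `R(u, v) w = ∇_u ∇_v w - ∇_v ∇_u w - ∇_[u,v] w` at the point `p`. -/
def curvature (g : E → E → E → ℝ) (p u v w : E) : E :=
  dirDeriv (fun q => christoffel g q v w) p u - dirDeriv (fun q => christoffel g q u w) p v
    + christoffel g p u (christoffel g p v w) - christoffel g p v (christoffel g p u w)

/-- The covariant derivative along the curve `γ` of the vector field `Y` along `γ`. -/
def covDeriv (g : E → E → E → ℝ) (γ Y : ℝ → E) (t : ℝ) : E :=
  deriv Y t + christoffel g (γ t) (deriv γ t) (Y t)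

/-- `γ : ℝ → E` is a geodesic of `g`. -/
structure IsGeodesic (g : E → E → E → ℝ) (γ : ℝ → E) : Prop where
  differentiable : Differentiable ℝ γ
  differentiable_velocity : Differentiable ℝ (deriv γ)
  equation : ∀ t, covDeriv g γ (deriv γ) t = 0

/-- `Y` is a Jacobi field along `γ`: `∇_γ' ∇_γ' Y + R(Y, γ') γ' = 0`. -/
structure IsJacobiField (g : E → E → E → ℝ) (γ Y : ℝ → E) : Prop where
  differentiable : Differentiable ℝ Y
  differentiable_covDeriv : Differentiable ℝ (covDeriv g γ Y)
  equation : ∀ t,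
    covDeriv g γ (covDeriv g γ Y) t + curvature g (γ t) (Y t) (deriv γ t) (deriv γ t) = 0

/-- `γ t₀` is conjugate to `γ 0` along the geodesic `γ` (meant for `t₀ ≠ 0`). -/
def IsConjugate (g : E → E → E → ℝ) (γ : ℝ → E) (t₀ : ℝ) : Prop :=
  ∃ Y : ℝ → E, IsJacobiField g γ Y ∧ (∃ t, Y t ≠ 0) ∧ Y 0 = 0 ∧ Y t₀ = 0

end PseudoRiem

/-- An inner product in the indefinite sense: a nondegenerate symmetric bilinear form. -/
structure InnerForm (V : Type*) [AddCommGroup V] [Module ℝ V] where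
  form : LinearMap.BilinForm ℝ V
  symm : form.IsSymm
  nondeg : form.Nondegenerate

/-! ### Two-step nilpotent groups in exponential coordinates -/

namespace TwoStep

variable {𝔫 : Type*} [LieRing 𝔫] [LieAlgebra ℝ 𝔫]

/-- The Lie algebra is 2-step nilpotent: all brackets are central. -/
def IsTwoStep (𝔫 : Type*) [LieRing 𝔫] [LieAlgebra ℝ 𝔫] : Prop :=
  ∀ x y : 𝔫, ⁅x, y⁆ ∈ LieAlgebra.center ℝ 𝔫

/-- The product of the simply connected Lie group `N` with Lie algebra `𝔫`, in exponential
coordinates: `exp p * exp q = exp (mul p q)`, with identity `0` and inverse `p ↦ -p`. -/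
def mul (p q : 𝔫) : 𝔫 := p + q + (1 / 2 : ℝ) • ⁅p, q⁆

theorem mul_zero (p : 𝔫) : mul p 0 = p := by simp [mul]

theorem zero_mul (p : 𝔫) : mul 0 p = p := by simp [mul]

theorem neg_mul_cancel (p : 𝔫) : mul (-p) p = 0 := by simp [mul]

theorem lie_lie_eq_zero (h : IsTwoStep 𝔫) (x y w : 𝔫) : ⁅w, ⁅x, y⁆⁆ = 0 :=
  (LieModule.mem_maxTrivSubmodule ℝ 𝔫 𝔫 _).1 (h x y) w

theorem mul_assoc (h : IsTwoStep 𝔫) (p q r : 𝔫) : mul (mul p q) r = mul p (mul q r) := by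
  have h1 : ⁅⁅p, q⁆, r⁆ = 0 := by rw [← lie_skew, lie_lie_eq_zero h, neg_zero]
  simp only [mul, add_lie, lie_add, smul_lie, lie_smul, lie_lie_eq_zero h, h1, smul_zero, add_zero,
    smul_add]
  abel

/-- The differential at `p` of the left translation by the inverse of `p`, applied to the tangent
vector `u` at `p`; it takes values in the tangent space `𝔫` at the identity. -/
def leftTriv [TopologicalSpace 𝔫] (p u : 𝔫) : 𝔫 :=
  deriv (fun s : ℝ => mul (-p) (p + s • u)) 0

theorem leftTriv_eq [TopologicalSpace 𝔫] [IsTopologicalAddGroup 𝔫] [ContinuousSMul ℝ 𝔫] [T2Space 𝔫]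
    (p u : 𝔫) : leftTriv p u = u - (1 / 2 : ℝ) • ⁅p, u⁆ := by
  have h : (fun s : ℝ => mul (-p) (p + s • u))
      = fun s : ℝ => ContinuousLinearMap.toSpanSingleton ℝ (u - (1 / 2 : ℝ) • ⁅p, u⁆) s := by
    funext s
    rw [ContinuousLinearMap.toSpanSingleton_apply, smul_sub, smul_comm s (1 / 2 : ℝ)]
    simp only [mul, neg_lie, lie_add, lie_self, lie_smul, smul_neg, smul_zero, neg_add]
    module
  rw [leftTriv, h, deriv, ContinuousLinearMap.fderiv]
  simp

/-- The left-invariant metric on `N` that is `β` at the identity. -/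
def metric [TopologicalSpace 𝔫] (β : InnerForm 𝔫) (p u w : 𝔫) : ℝ :=
  β.form (leftTriv p u) (leftTriv p w)

/-- The center of the Lie algebra, as a subspace. -/
abbrev cent (𝔫 : Type*) [LieRing 𝔫] [LieAlgebra ℝ 𝔫] : Submodule ℝ 𝔫 :=
  (LieAlgebra.center ℝ 𝔫).toSubmodule

/-- The orthogonal complement of the center. -/
abbrev vee (β : InnerForm 𝔫) : Submodule ℝ 𝔫 := β.form.orthogonal (cent 𝔫)

variable [FiniteDimensional ℝ 𝔫]

/-- `adDagger β x` is the adjoint of `ad x` with respect to the inner product. -/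
def adDagger (β : InnerForm 𝔫) (x : 𝔫) : 𝔫 →ₗ[ℝ] 𝔫 :=
  β.form.leftAdjointOfNondegenerate β.nondeg (LieAlgebra.ad ℝ 𝔫 x)

theorem form_adDagger (β : InnerForm 𝔫) (x z y : 𝔫) :
    β.form (adDagger β x z) y = β.form z ⁅x, y⁆ :=
  LinearMap.BilinForm.isAdjointPairLeftAdjointOfNondegenerate β.form β.nondeg
    (LieAlgebra.ad ℝ 𝔫 x) z y

theorem eq_of_form_eq (β : InnerForm 𝔫) {x y : 𝔫} (h : ∀ w, β.form x w = β.form y w) : x = y :=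
  (β.form.toDual β.nondeg).injective (by ext w; exact h w)

theorem adDagger_mem_vee (β : InnerForm 𝔫) (x z : 𝔫) : adDagger β x z ∈ vee β := by
  intro y hy
  have h : ⁅x, y⁆ = 0 := (LieModule.mem_maxTrivSubmodule ℝ 𝔫 𝔫 y).1 hy x
  have h2 := form_adDagger β x z y
  rw [h, map_zero] at h2
  exact (β.symm.eq y (adDagger β x z)).trans h2

/-- The operator `J_z : x ↦ (ad x)† z` on the orthogonal complement of the center. -/
def J (β : InnerForm 𝔫) (z : 𝔫) : Module.End ℝ (vee β) where
  toFun x := ⟨adDagger β x z, adDagger_mem_vee β x z⟩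
  map_add' x y := Subtype.ext <| eq_of_form_eq β fun w => by
    simp [form_adDagger]
  map_smul' c x := Subtype.ext <| eq_of_form_eq β fun w => by
    simp [form_adDagger]

end TwoStep

/-! ### Spectral data -/

/-- `T` is diagonalizable over the reals: there is a basis of eigenvectors. -/
def IsRealDiagonalizable {V : Type*} [AddCommGroup V] [Module ℝ V] (T : Module.End ℝ V) : Prop :=
  ∃ b : Module.Basis (Fin (Module.finrank ℝ V)) ℝ V, ∀ i, ∃ μ : ℝ, T (b i) = μ • b i

/-- The eigenvalues of `T` are, without repetition, the negative numbers `-(a k) ^ 2` and the positive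
numbers `(b l) ^ 2`, with `a k > 0` and `b l > 0`. -/
structure EigenvalueList {V : Type*} [AddCommGroup V] [Module ℝ V] (T : Module.End ℝ V)
    {q r : ℕ} (a : Fin q → ℝ) (b : Fin r → ℝ) : Prop where
  a_pos : ∀ k, 0 < a k
  b_pos : ∀ l, 0 < b l
  a_inj : Function.Injective a
  b_inj : Function.Injective b
  eigenvalue_iff : ∀ μ : ℝ, T.HasEigenvalue μ ↔ (∃ k, μ = -(a k) ^ 2) ∨ (∃ l, μ = (b l) ^ 2)

/-- The eigenspaces of `T` for the eigenvalues `-(a k) ^ 2` and `(b l) ^ 2`. -/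
def eigenFamily {V : Type*} [AddCommGroup V] [Module ℝ V] (T : Module.End ℝ V)
    {q r : ℕ} (a : Fin q → ℝ) (b : Fin r → ℝ) : Fin q ⊕ Fin r → Submodule ℝ V
  | Sum.inl k => T.eigenspace (-(a k) ^ 2)
  | Sum.inr l => T.eigenspace ((b l) ^ 2)

/-- `x` is the sum of the components `A k` and `B l` in these eigenspaces. -/
structure EigenComponents {V : Type*} [AddCommGroup V] [Module ℝ V] (T : Module.End ℝ V)
    {q r : ℕ} (a : Fin q → ℝ) (b : Fin r → ℝ) (x : V) (A : Fin q → V) (B : Fin r → V) : Prop where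
  A_mem : ∀ k, A k ∈ eigenFamily T a b (Sum.inl k)
  B_mem : ∀ l, B l ∈ eigenFamily T a b (Sum.inr l)
  sum_eq : x = ∑ k, A k + ∑ l, B l

/-- Hyperbolic cotangent. -/
def realCoth (x : ℝ) : ℝ := Real.cosh x / Real.sinh x

end

/-! Left translation moves the whole problem into the fixed vector space `𝔫`. If `ξ` is the
left-trivialized velocity, the geodesic equation becomes the Euler equation `ξ' = (ad ξ)† ξ`. A
trivialized Jacobi field `η` satisfies its linearization: `η' = ζ - ⁅ξ, η⁆` and `ζ' = (ad ξ)† ζ +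
(ad ζ)† ξ`, with `ζ` the variation of `ξ` (`isConjugate_iff`).

Let `e` span the center and put `κ = ⟨e, e⟩ ≠ 0`. Every bracket is a multiple of `e` and `(ad x)†`
takes values in the complement of the center, so the central coefficients `r` of `ξ` and `s` of `ζ`
are constant. With `x`, `v`, `w` the components of `ξ`, `η`, `ζ` orthogonal to the center, `u = ⟨e,
η⟩` and `J = J_e`, what remains is `x' = r J x`, `v' = w`, `w' = s J x + r J w`, `u' = κ s - ⟨J x,
v⟩` (`isTrivJacobi_iff`). Two choices of `e` suffice: a unit vector with `r = 0`, or the central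
part of the initial velocity with `r = 1`.

For `r = 0` the curve `x` is constant and `v`, `u` are polynomials in time, quadratic and cubic; the
boundary conditions leave one scalar equation (`hasConjugateSolution_const_iff`).

For `r = 1`, with `E` the flow of `J`, integration gives `v = s τ x + (E τ - 1) h`, and the
conditions at `t` read `(E t - 1) h = -s t E t x₀` and `s (κ + ⟨x₀, x₀⟩) = ⟨J x₀, h⟩`
(`hasConjugateSolution_flow_iff`). If `E t - 1` is singular, there is a solution with `s = 0`; this
yields the times `2πn/λ_k`. Otherwise `h = -s t R` with `R = (1 + coth(tJ/2)) x₀ / 2`, and on the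
eigenspaces of `J²` the second condition becomes the cot/coth equation
(`IsSpectralData.hasConjugateSolution_iff`). -/

/-! ### Derivatives tested against linear functionals -/

/-- The curve `f` in a real vector space has derivative `f'` at `t` when tested against every linear
functional. -/
def HasWeakDerivAt {V : Type*} [AddCommGroup V] [Module ℝ V] (f : ℝ → V) (f' : V) (t : ℝ) : Prop :=
  ∀ φ : Module.Dual ℝ V, HasDerivAt (fun s => φ (f s)) (φ f') t

namespace HasWeakDerivAt

variable {V W U : Type*} [AddCommGroup V] [Module ℝ V] [AddCommGroup W] [Module ℝ W]
  [AddCommGroup U] [Module ℝ U] {f g : ℝ → V} {f' g' : V} {t : ℝ}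

theorem const (v : V) (t : ℝ) : HasWeakDerivAt (fun _ => v) 0 t := fun φ => by
  simpa using hasDerivAt_const t (φ v)

theorem add (hf : HasWeakDerivAt f f' t) (hg : HasWeakDerivAt g g' t) :
    HasWeakDerivAt (fun s => f s + g s) (f' + g') t := fun φ => by
  simpa using (hf φ).fun_add (hg φ)

theorem sub (hf : HasWeakDerivAt f f' t) (hg : HasWeakDerivAt g g' t) :
    HasWeakDerivAt (fun s => f s - g s) (f' - g') t := fun φ => by
  simpa using (hf φ).fun_sub (hg φ)

theorem smul {c : ℝ → ℝ} {c' : ℝ} (hc : HasDerivAt c c' t) (hf : HasWeakDerivAt f f' t) :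
    HasWeakDerivAt (fun s => c s • f s) (c t • f' + c' • f t) t := fun φ => by
  simpa [add_comm] using hc.fun_mul (hf φ)

theorem smul_const {c : ℝ → ℝ} {c' : ℝ} (hc : HasDerivAt c c' t) (v : V) :
    HasWeakDerivAt (fun s => c s • v) (c' • v) t := by
  simpa using smul hc (const v t)

theorem const_smul (c : ℝ) (hf : HasWeakDerivAt f f' t) :
    HasWeakDerivAt (fun s => c • f s) (c • f') t := by
  simpa using smul (hasDerivAt_const t c) hf

theorem map (L : V →ₗ[ℝ] W) (hf : HasWeakDerivAt f f' t) :
    HasWeakDerivAt (fun s => L (f s)) (L f') t := fun φ => hf (φ ∘ₗ L)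

theorem sum {ι : Type*} {s : Finset ι} {f : ι → ℝ → V} {f' : ι → V}
    (h : ∀ i ∈ s, HasWeakDerivAt (f i) (f' i) t) :
    HasWeakDerivAt (fun τ => ∑ i ∈ s, f i τ) (∑ i ∈ s, f' i) t := fun φ => by
  simpa using HasDerivAt.fun_sum fun i hi => h i hi φ

theorem congr_deriv (hf : HasWeakDerivAt f f' t) (h : f' = g') : HasWeakDerivAt f g' t := h ▸ hf

/-- Expanding the first argument in a basis reduces this to the scalar product rule, so neither
space needs a topology. -/
theorem bilin [FiniteDimensional ℝ V] (B : V →ₗ[ℝ] W →ₗ[ℝ] U) {k : ℝ → W} {k' : W}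
    (hf : HasWeakDerivAt f f' t) (hk : HasWeakDerivAt k k' t) :
    HasWeakDerivAt (fun s => B (f s) (k s)) (B f' (k t) + B (f t) k') t := by
  let b := Module.finBasis ℝ V
  have hB : ∀ x y, B x y = ∑ i, b.coord i x • B (b i) y := fun x y => by
    conv_lhs => rw [← b.sum_repr x]
    simp only [map_sum, map_smul, LinearMap.sum_apply, LinearMap.smul_apply, Module.Basis.coord_apply]
  have h := HasWeakDerivAt.sum (s := Finset.univ) fun i _ => smul (hf (b.coord i)) (hk.map (B (b i)))
  rw [funext fun s => hB (f s) (k s), hB f', hB (f t)]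
  refine h.congr_deriv ?_
  rw [← Finset.sum_add_distrib]
  exact Finset.sum_congr rfl fun i _ => add_comm _ _

theorem _root_.eq_of_forall_dual {x y : V} (h : ∀ φ : Module.Dual ℝ V, φ x = φ y) : x = y :=
  sub_eq_zero.1 <| (Module.forall_dual_apply_eq_zero_iff ℝ _).1 fun φ => by simp [h φ]

theorem unique (hf : HasWeakDerivAt f f' t) (hg : HasWeakDerivAt f g' t) : f' = g' :=
  eq_of_forall_dual fun φ => (hf φ).unique (hg φ)

theorem eq_of_deriv_eq_zero (hf : ∀ t, HasWeakDerivAt f 0 t) (s t : ℝ) : f s = f t :=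
  eq_of_forall_dual fun φ =>
    is_const_of_deriv_eq_zero (fun τ => (hf τ φ).differentiableAt)
      (fun τ => by simpa using (hf τ φ).deriv) s t

section TVS

variable [TopologicalSpace V] [ContinuousSMul ℝ V]

open Topology in
theorem _root_.HasDerivAt.map_tvs [TopologicalSpace W] [ContinuousSMul ℝ W]
    (L : V →L[ℝ] W) (h : HasDerivAt f f' t) : HasDerivAt (fun s => L (f s)) (L f') t := by
  have h1 := (hasFDerivAt_iff_isLittleOTVS.1 h.hasFDerivAt)
  refine HasFDerivAt.of_isLittleOTVS ?_
  have h2 := (L.isBigOTVS_comp (l := 𝓝 t)).trans_isLittleOTVS h1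
  refine h2.congr (fun s => ?_) (fun _ => rfl)
  simp

variable [IsTopologicalAddGroup V] [FiniteDimensional ℝ V] [T2Space V]

/-- In a finite-dimensional Hausdorff space all functionals are continuous and coordinates give a
homeomorphism with `ℝⁿ`, where derivatives are taken coordinatewise. -/
theorem _root_.hasDerivAt_iff_hasWeakDerivAt : HasDerivAt f f' t ↔ HasWeakDerivAt f f' t := by
  refine ⟨fun h φ => h.map_tvs (LinearMap.toContinuousLinearMap φ), fun h => ?_⟩
  let e := (Module.finBasis ℝ V).equivFunL
  have h1 : HasDerivAt (fun s => e (f s)) (e f') t :=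
    hasDerivAt_pi.2 fun i => h ((Module.finBasis ℝ V).coord i)
  simpa using h1.map_tvs (e.symm : (_ → ℝ) →L[ℝ] V)

theorem _root_.DifferentiableAt.hasWeakDerivAt (h : DifferentiableAt ℝ f t) :
    HasWeakDerivAt f (deriv f t) t := by
  -- No norm is given on `V`, so the value of `fderiv` is read off its definition: `0` if `0` is a
  -- derivative, otherwise a chosen derivative.
  rw [← hasDerivAt_iff_hasWeakDerivAt, deriv, ← hasFDerivAt_iff_hasDerivAt, fderiv, fderivWithin]
  have h' : DifferentiableWithinAt ℝ f Set.univ t := by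
    obtain ⟨L, hL⟩ := h
    exact ⟨L, by simpa [HasFDerivWithinAt, HasFDerivAt] using hL⟩
  split_ifs with h0
  · simpa [HasFDerivWithinAt, HasFDerivAt] using h0
  · simpa [HasFDerivWithinAt, HasFDerivAt] using Classical.choose_spec h'

theorem differentiableAt (h : HasWeakDerivAt f f' t) : DifferentiableAt ℝ f t :=
  ⟨_, (hasDerivAt_iff_hasWeakDerivAt.2 h).hasFDerivAt⟩

theorem deriv_eq (h : HasWeakDerivAt f f' t) : deriv f t = f' :=
  h.differentiableAt.hasWeakDerivAt.unique h

end TVS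

end HasWeakDerivAt

noncomputable section

/-! ### Levi-Civita connection and curvature of the left-invariant metric -/

namespace TwoStep

open PseudoRiem

variable {𝔫 : Type*} [LieRing 𝔫] [LieAlgebra ℝ 𝔫]

variable (𝔫) in
/-- The Lie bracket as a bilinear map. -/
def bracketMap : 𝔫 →ₗ[ℝ] 𝔫 →ₗ[ℝ] 𝔫 :=
  LinearMap.mk₂ ℝ (fun x y => ⁅x, y⁆) (fun _ _ _ => add_lie _ _ _) (fun _ _ _ => smul_lie _ _ _)
    (fun _ _ _ => lie_add _ _ _) (fun _ _ _ => lie_smul _ _ _)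

theorem lie_lie_eq_zero_left (h : IsTwoStep 𝔫) (x y w : 𝔫) : ⁅⁅x, y⁆, w⁆ = 0 := by
  rw [← lie_skew, lie_lie_eq_zero h, neg_zero]

theorem hasWeakDerivAt_line {V : Type*} [AddCommGroup V] [Module ℝ V] (p u : V) (t : ℝ) :
    HasWeakDerivAt (fun s : ℝ => p + s • u) u t := by
  simpa using (HasWeakDerivAt.const p t).add (HasWeakDerivAt.smul_const (hasDerivAt_id t) u)

theorem _root_.HasWeakDerivAt.lie [FiniteDimensional ℝ 𝔫] {f g : ℝ → 𝔫} {f' g' : 𝔫} {t : ℝ} (hf : HasWeakDerivAt f f' t)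
    (hg : HasWeakDerivAt g g' t) :
    HasWeakDerivAt (fun s => ⁅f s, g s⁆) (⁅f', g t⁆ + ⁅f t, g'⁆) t :=
  hf.bilin (bracketMap 𝔫) hg

section LeftTriv

variable [TopologicalSpace 𝔫] [IsTopologicalAddGroup 𝔫] [ContinuousSMul ℝ 𝔫] [T2Space 𝔫]

/-- `leftTriv p` is `1 - ad p / 2` and `ad p` squares to zero, so `1 + ad p / 2` is its inverse. -/
theorem leftTriv_add_lie (h : IsTwoStep 𝔫) (p c : 𝔫) :
    leftTriv p (c + (1 / 2 : ℝ) • ⁅p, c⁆) = c := by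
  simp [leftTriv_eq, lie_lie_eq_zero h]

theorem leftTriv_injective (h : IsTwoStep 𝔫) (p : 𝔫) : Function.Injective (leftTriv p) := by
  intro u w huw
  have key : ∀ u : 𝔫, leftTriv p u + (1 / 2 : ℝ) • ⁅p, leftTriv p u⁆ = u := fun u => by
    simp [leftTriv_eq, lie_lie_eq_zero h]
  rw [← key u, huw, key w]

theorem lie_leftTriv_right (h : IsTwoStep 𝔫) (p u w : 𝔫) : ⁅w, leftTriv p u⁆ = ⁅w, u⁆ := by
  simp [leftTriv_eq, lie_lie_eq_zero h]

theorem lie_leftTriv_left (h : IsTwoStep 𝔫) (p u w : 𝔫) : ⁅leftTriv p u, w⁆ = ⁅u, w⁆ := by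
  simp [leftTriv_eq, lie_lie_eq_zero_left h]

theorem leftTriv_add (p u w : 𝔫) : leftTriv p (u + w) = leftTriv p u + leftTriv p w := by
  simp only [leftTriv_eq, lie_add]; module

theorem leftTriv_sub (p u w : 𝔫) : leftTriv p (u - w) = leftTriv p u - leftTriv p w := by
  simp only [leftTriv_eq, lie_sub]; module

end LeftTriv

theorem form_comm {β : InnerForm 𝔫} (x y : 𝔫) : β.form x y = β.form y x := β.symm.eq x y

variable [FiniteDimensional ℝ 𝔫]

/-- The adjoint of `ad x` applied to `z`, as a bilinear map in `x` and `z`. -/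
def adj (β : InnerForm 𝔫) : 𝔫 →ₗ[ℝ] 𝔫 →ₗ[ℝ] 𝔫 :=
  LinearMap.mk₂ ℝ (fun x z => adDagger β x z)
    (fun x y z => eq_of_form_eq β fun w => by simp [form_adDagger])
    (fun c x z => eq_of_form_eq β fun w => by simp [form_adDagger])
    (fun _ _ _ => map_add _ _ _) (fun _ _ _ => map_smul _ _ _)

variable {β : InnerForm 𝔫}

theorem form_adj (x z y : 𝔫) : β.form (adj β x z) y = β.form z ⁅x, y⁆ := form_adDagger β x z y

theorem adj_lie_left (h : IsTwoStep 𝔫) (x y z : 𝔫) : adj β ⁅x, y⁆ z = 0 :=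
  eq_of_form_eq β fun w => by simp [form_adj, lie_lie_eq_zero_left h]

variable (β) in
/-- The Christoffel map of the left-invariant metric in the left trivialization, up to the bracket
term: the symmetrization of the coadjoint action. -/
def symAdj : 𝔫 →ₗ[ℝ] 𝔫 →ₗ[ℝ] 𝔫 := (-(1 / 2) : ℝ) • (adj β + (adj β).flip)

theorem symAdj_apply (x y : 𝔫) : symAdj β x y = (-(1 / 2) : ℝ) • (adj β x y + adj β y x) := rfl

theorem symAdj_comm (x y : 𝔫) : symAdj β x y = symAdj β y x := by
  rw [symAdj_apply, symAdj_apply, add_comm]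

theorem symAdj_lie_right (h : IsTwoStep 𝔫) (x y w : 𝔫) :
    symAdj β x ⁅y, w⁆ = (-(1 / 2) : ℝ) • adj β x ⁅y, w⁆ := by
  rw [symAdj_apply, adj_lie_left h, add_zero]

variable [TopologicalSpace 𝔫] [IsTopologicalAddGroup 𝔫] [ContinuousSMul ℝ 𝔫] [T2Space 𝔫]

theorem _root_.HasWeakDerivAt.leftTriv {f g : ℝ → 𝔫} {f' g' : 𝔫} {t : ℝ} (hf : HasWeakDerivAt f f' t)
    (hg : HasWeakDerivAt g g' t) :
    HasWeakDerivAt (fun s => leftTriv (f s) (g s))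
      (leftTriv (f t) g' - (1 / 2 : ℝ) • ⁅f', g t⁆) t := by
  simp only [leftTriv_eq]
  refine (hg.sub ((HasWeakDerivAt.lie hf hg).const_smul (1 / 2 : ℝ))).congr_deriv ?_
  module

theorem dirDeriv_metric (p u w v : 𝔫) :
    dirDeriv (fun q => metric β q w v) p u
      = β.form (-(1 / 2 : ℝ) • ⁅u, w⁆) (leftTriv p v)
        + β.form (leftTriv p w) (-(1 / 2 : ℝ) • ⁅u, v⁆) := by
  have hl := fun w : 𝔫 => HasWeakDerivAt.leftTriv (hasWeakDerivAt_line p u 0) (.const w 0)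
  have := ((hl w).bilin β.form (hl v)).deriv_eq
  rw [dirDeriv]
  refine this.trans ?_
  simp [leftTriv_eq]

theorem adj_leftTriv_left (h : IsTwoStep 𝔫) (p u w : 𝔫) : adj β (leftTriv p u) w = adj β u w :=
  eq_of_form_eq β fun y => by rw [form_adj, form_adj, lie_leftTriv_left h]

/-- The metric depends on the point only through `leftTriv`, whose derivative is a bracket; moving
brackets across the form gives adjoints. Since `christoffel` is a choice, one exhibits a solution of
the defining equation and then uses nondegeneracy and the surjectivity of `leftTriv p` for
uniqueness. -/
theorem christoffel_metric (h : IsTwoStep 𝔫) (p u w : 𝔫) :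
    christoffel (metric β) p u w
      = symAdj β (leftTriv p u) (leftTriv p w)
        + (1 / 2 : ℝ) • ⁅p, symAdj β (leftTriv p u) (leftTriv p w)⁆ := by
  set c := symAdj β (leftTriv p u) (leftTriv p w) with hc
  have hC : IsChristoffel (metric β) p u w (c + (1 / 2 : ℝ) • ⁅p, c⁆) := by
    intro v
    rw [dirDeriv_metric, dirDeriv_metric, dirDeriv_metric, metric, leftTriv_add_lie h, hc,
      symAdj_apply, ← lie_skew w u, ← lie_skew v u, ← lie_skew v w]
    simp only [map_smul, map_add, map_neg, LinearMap.smul_apply, LinearMap.add_apply, form_adj,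
      LinearMap.neg_apply, lie_leftTriv_left h, lie_leftTriv_right h, smul_eq_mul]
    rw [form_comm (leftTriv p w) ⁅u, v⁆]
    ring
  have hE : IsChristoffel (metric β) p u w (christoffel (metric β) p u w) :=
    Classical.epsilon_spec (p := IsChristoffel (metric β) p u w) ⟨_, hC⟩
  refine leftTriv_injective h p (eq_of_form_eq β fun y => ?_)
  have := (hE (y + (1 / 2 : ℝ) • ⁅p, y⁆)).trans (hC _).symm
  simpa only [metric, leftTriv_add_lie h] using this

theorem leftTriv_christoffel (h : IsTwoStep 𝔫) (p u w : 𝔫) :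
    leftTriv p (christoffel (metric β) p u w) = symAdj β (leftTriv p u) (leftTriv p w) := by
  rw [christoffel_metric h, leftTriv_add_lie h]

theorem leftTriv_dirDeriv_christoffel (h : IsTwoStep 𝔫) (p u v w : 𝔫) :
    leftTriv p (dirDeriv (fun q => christoffel (metric β) q v w) p u)
      = (1 / 4 : ℝ) • (adj β v ⁅u, w⁆ + adj β w ⁅u, v⁆)
        + (1 / 2 : ℝ) • ⁅u, symAdj β (leftTriv p v) (leftTriv p w)⁆ := by
  have hl := fun w : 𝔫 => HasWeakDerivAt.leftTriv (hasWeakDerivAt_line p u 0) (.const w 0)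
  have hS := (hl v).bilin (symAdj β) (hl w)
  have hd := (hS.add ((HasWeakDerivAt.lie (hasWeakDerivAt_line p u 0) hS).const_smul (1 / 2 : ℝ)))
  have := hd.deriv_eq
  simp only [christoffel_metric h, dirDeriv]
  rw [this]
  have h0 : ∀ p : 𝔫, leftTriv p 0 = 0 := fun p => by simp [leftTriv_eq]
  simp only [zero_smul, add_zero, h0, zero_sub, leftTriv_eq, symAdj_apply, map_neg, map_smul,
    LinearMap.neg_apply, LinearMap.smul_apply, adj_lie_left h, lie_add, lie_smul,
    lie_neg, lie_lie_eq_zero h, map_sub, LinearMap.sub_apply, lie_sub, smul_zero, sub_zero]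
  module

/-- The curvature of the left-invariant metric in the left trivialization. -/
theorem leftTriv_curvature (h : IsTwoStep 𝔫) (p y x : 𝔫) {η ξ : 𝔫} (hη : leftTriv p y = η)
    (hξ : leftTriv p x = ξ) :
    leftTriv p (curvature (metric β) p y x x)
      = -(3 / 4 : ℝ) • adj β ξ ⁅ξ, η⁆ + (1 / 2 : ℝ) • ⁅η, symAdj β ξ ξ⁆
        - (1 / 2 : ℝ) • ⁅ξ, symAdj β ξ η⁆ + symAdj β η (symAdj β ξ ξ)
        - symAdj β ξ (symAdj β ξ η) := by
  have hlη : ∀ w, ⁅y, w⁆ = ⁅η, w⁆ := fun w => by rw [← hη, lie_leftTriv_left h]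
  have hlξ : ∀ w, ⁅x, w⁆ = ⁅ξ, w⁆ := fun w => by rw [← hξ, lie_leftTriv_left h]
  have hrξ : ∀ w, ⁅w, x⁆ = ⁅w, ξ⁆ := fun w => by rw [← hξ, lie_leftTriv_right h]
  have hrη : ∀ w, ⁅w, y⁆ = ⁅w, η⁆ := fun w => by rw [← hη, lie_leftTriv_right h]
  have haη : adj β y = adj β η := LinearMap.ext fun w => by rw [← hη, adj_leftTriv_left h]
  have haξ : adj β x = adj β ξ := LinearMap.ext fun w => by rw [← hξ, adj_leftTriv_left h]
  simp only [curvature, leftTriv_add, leftTriv_sub, leftTriv_christoffel h,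
    leftTriv_dirDeriv_christoffel h, hη, hξ, hlη, hlξ, hrξ, hrη, haη, haξ, lie_self, map_zero]
  rw [← lie_skew η ξ, map_neg, symAdj_comm η ξ]
  module

end TwoStep

end

noncomputable section

/-! ### Geodesics and Jacobi fields in the left trivialization -/

namespace TwoStep

open PseudoRiem

variable {𝔫 : Type*} [LieRing 𝔫] [LieAlgebra ℝ 𝔫] [FiniteDimensional ℝ 𝔫] {β : InnerForm 𝔫}

/-- The first parenthesis is the derivative of the trivialized covariant derivative `ζ - ⁅ξ, η⁆ / 2
+ symAdj ξ η` along the Euler equation; connection and curvature terms follow. All terms in `η`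
cancel, and the linearized Euler equation is left. -/
theorem jacobi_algebra (h : IsTwoStep 𝔫) (ξ η ζ ζ' : 𝔫) :
    (ζ' - (1 / 2 : ℝ) • (⁅-symAdj β ξ ξ, η⁆ + ⁅ξ, ζ - ⁅ξ, η⁆⁆)
        + (symAdj β (-symAdj β ξ ξ) η + symAdj β ξ (ζ - ⁅ξ, η⁆)))
      + (1 / 2 : ℝ) • ⁅ξ, ζ - (1 / 2 : ℝ) • ⁅ξ, η⁆ + symAdj β ξ η⁆
      + symAdj β ξ (ζ - (1 / 2 : ℝ) • ⁅ξ, η⁆ + symAdj β ξ η)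
      + (-(3 / 4 : ℝ) • adj β ξ ⁅ξ, η⁆ + (1 / 2 : ℝ) • ⁅η, symAdj β ξ ξ⁆
        - (1 / 2 : ℝ) • ⁅ξ, symAdj β ξ η⁆ + symAdj β η (symAdj β ξ ξ)
        - symAdj β ξ (symAdj β ξ η))
      = ζ' - (adj β ξ ζ + adj β ζ ξ) := by
  have h1 : symAdj β ξ ζ = (-(1 / 2) : ℝ) • (adj β ξ ζ + adj β ζ ξ) := symAdj_apply _ _
  rw [← lie_skew η (symAdj β ξ ξ), symAdj_comm η (symAdj β ξ ξ)]
  simp only [map_sub, map_add, map_neg, map_smul, LinearMap.neg_apply, lie_sub, lie_add, lie_smul,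
    lie_lie_eq_zero h, symAdj_lie_right h, neg_lie, h1]
  module

variable [TopologicalSpace 𝔫] [IsTopologicalAddGroup 𝔫] [ContinuousSMul ℝ 𝔫] [T2Space 𝔫]

/-- The left trivialization of the velocity of `γ`. -/
def bodyVelocity (γ : ℝ → 𝔫) (t : ℝ) : 𝔫 := leftTriv (γ t) (deriv γ t)

theorem leftTriv_covDeriv (h : IsTwoStep 𝔫) {γ Y : ℝ → 𝔫} {t : ℝ} {η' : 𝔫}
    (hγ : DifferentiableAt ℝ γ t) (hY : DifferentiableAt ℝ Y t)
    (hη : HasWeakDerivAt (fun s => leftTriv (γ s) (Y s)) η' t) :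
    leftTriv (γ t) (covDeriv (metric β) γ Y t)
      = η' + (1 / 2 : ℝ) • ⁅bodyVelocity γ t, leftTriv (γ t) (Y t)⁆
        + symAdj β (bodyVelocity γ t) (leftTriv (γ t) (Y t)) := by
  rw [covDeriv, leftTriv_add, leftTriv_christoffel h,
    hη.unique (hγ.hasWeakDerivAt.leftTriv hY.hasWeakDerivAt), bodyVelocity,
    lie_leftTriv_left h, lie_leftTriv_right h, sub_add_cancel]

theorem hasWeakDerivAt_add_lie {γ η : ℝ → 𝔫} {η' : 𝔫} {t : ℝ} (hγ : DifferentiableAt ℝ γ t)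
    (hη : HasWeakDerivAt η η' t) :
    DifferentiableAt ℝ (fun s => η s + (1 / 2 : ℝ) • ⁅γ s, η s⁆) t :=
  (hη.add ((hγ.hasWeakDerivAt.lie hη).const_smul _)).differentiableAt

/-- The Euler equation of a geodesic. -/
theorem hasWeakDerivAt_bodyVelocity (h : IsTwoStep 𝔫) {γ : ℝ → 𝔫}
    (hγ : IsGeodesic (metric β) γ) (t : ℝ) :
    HasWeakDerivAt (bodyVelocity γ) (-symAdj β (bodyVelocity γ t) (bodyVelocity γ t)) t := by
  have hd := (hγ.differentiable t).hasWeakDerivAt.leftTriv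
    (hγ.differentiable_velocity t).hasWeakDerivAt
  have := leftTriv_covDeriv (β := β) h (hγ.differentiable t) (hγ.differentiable_velocity t) hd
  rw [hγ.equation t, ← bodyVelocity, lie_self] at this
  refine HasWeakDerivAt.congr_deriv hd ?_
  rw [eq_neg_iff_add_eq_zero]
  simpa [leftTriv_eq] using this.symm

/-- `η` is a Jacobi field along a geodesic with body velocity `ξ`, in the left trivialization, and
`ζ` the variation of the body velocity. -/
structure IsTrivJacobi (β : InnerForm 𝔫) (ξ η ζ : ℝ → 𝔫) : Prop where
  deriv_field : ∀ t, HasWeakDerivAt η (ζ t - ⁅ξ t, η t⁆) t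
  deriv_velocity : ∀ t, HasWeakDerivAt ζ (adj β (ξ t) (ζ t) + adj β (ζ t) (ξ t)) t

theorem IsTrivJacobi.of_isJacobiField (h : IsTwoStep 𝔫) {γ Y : ℝ → 𝔫}
    (hγ : IsGeodesic (metric β) γ) (hY : IsJacobiField (metric β) γ Y) :
    ∃ ζ, IsTrivJacobi β (bodyVelocity γ) (fun t => leftTriv (γ t) (Y t)) ζ := by
  set ξ := bodyVelocity γ with hξ
  set η := fun t => leftTriv (γ t) (Y t) with hη
  set P := fun t => leftTriv (γ t) (covDeriv (metric β) γ Y t) with hP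
  have hηd := fun t => (hγ.differentiable t).hasWeakDerivAt.leftTriv (hY.differentiable t).hasWeakDerivAt
  have hPd := fun t => (hγ.differentiable t).hasWeakDerivAt.leftTriv
    (hY.differentiable_covDeriv t).hasWeakDerivAt
  have hξd := hasWeakDerivAt_bodyVelocity h hγ
  -- Chosen so that `ζ = η' + ⁅ξ, η⁆`, by the formula for the trivialized covariant derivative `P`.
  let ζ := fun t => P t + (1 / 2 : ℝ) • ⁅ξ t, η t⁆ - symAdj β (ξ t) (η t)
  have hη' : ∀ t, HasWeakDerivAt η (ζ t - ⁅ξ t, η t⁆) t := fun t => by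
    refine (hηd t).congr_deriv ?_
    have := leftTriv_covDeriv (β := β) h (hγ.differentiable t) (hY.differentiable t) (hηd t)
    simp only [ζ, hP, this, hη, hξ]
    module
  refine ⟨ζ, hη', fun t => ?_⟩
  have hζ := ((hPd t).add (((hξd t).lie (hη' t)).const_smul (1 / 2 : ℝ))).sub
    ((hξd t).bilin (symAdj β) (hη' t))
  refine HasWeakDerivAt.congr_deriv hζ ?_
  rw [← sub_eq_zero, ← jacobi_algebra h (ξ t) (η t)]
  have hJ := congrArg (leftTriv (γ t)) (hY.equation t)
  rw [leftTriv_add, leftTriv_covDeriv h (hγ.differentiable t) (hY.differentiable_covDeriv t) (hPd t),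
    leftTriv_curvature h (γ t) (Y t) (deriv γ t) rfl rfl] at hJ
  have h0 : leftTriv (γ t) 0 = 0 := by simp [leftTriv_eq]
  rw [h0] at hJ
  rw [← hJ]
  have hPt : P t = ζ t - (1 / 2 : ℝ) • ⁅ξ t, η t⁆ + symAdj β (ξ t) (η t) := by
    simp only [ζ]; module
  change _ = _ + (1 / 2 : ℝ) • ⁅ξ t, P t⁆ + symAdj β (ξ t) (P t) + _
  rw [hPt]
  simp only [hξ, hη, bodyVelocity]
  module

theorem IsTrivJacobi.isJacobiField (h : IsTwoStep 𝔫) {γ η ζ : ℝ → 𝔫}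
    (hγ : IsGeodesic (metric β) γ) (hη : IsTrivJacobi β (bodyVelocity γ) η ζ) :
    IsJacobiField (metric β) γ (fun t => η t + (1 / 2 : ℝ) • ⁅γ t, η t⁆) := by
  set ξ := bodyVelocity γ with hξ
  set Y := fun t => η t + (1 / 2 : ℝ) • ⁅γ t, η t⁆ with hYdef
  have hY : Differentiable ℝ Y := fun t =>
    hasWeakDerivAt_add_lie (hγ.differentiable t) (hη.deriv_field t)
  have hYη : (fun t => leftTriv (γ t) (Y t)) = η := funext fun t => leftTriv_add_lie h _ _
  have hYη' : ∀ t, leftTriv (γ t) (Y t) = η t := fun t => leftTriv_add_lie h _ _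
  let P := fun t => ζ t - (1 / 2 : ℝ) • ⁅ξ t, η t⁆ + symAdj β (ξ t) (η t)
  have hξd := hasWeakDerivAt_bodyVelocity h hγ
  have hPd := fun t => ((hη.deriv_velocity t).sub
    (((hξd t).lie (hη.deriv_field t)).const_smul (1 / 2 : ℝ))).add
    ((hξd t).bilin (symAdj β) (hη.deriv_field t))
  have hcovP : ∀ t, leftTriv (γ t) (covDeriv (metric β) γ Y t) = P t := fun t => by
    have hd : HasWeakDerivAt (fun t => leftTriv (γ t) (Y t)) (ζ t - ⁅ξ t, η t⁆) t := by
      rw [hYη]; exact hη.deriv_field t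
    rw [leftTriv_covDeriv h (hγ.differentiable t) (hY t) hd, hYη']
    simp only [P, hξ]
    module
  have hcov : covDeriv (metric β) γ Y = fun t => P t + (1 / 2 : ℝ) • ⁅γ t, P t⁆ := funext fun t =>
    leftTriv_injective h (γ t) ((hcovP t).trans (leftTriv_add_lie h _ _).symm)
  have hcovd : Differentiable ℝ (covDeriv (metric β) γ Y) := fun t => by
    rw [hcov]
    exact hasWeakDerivAt_add_lie (hγ.differentiable t) (hPd t)
  refine ⟨hY, hcovd, fun t => leftTriv_injective h (γ t) ?_⟩
  have hcovP' : (fun t => leftTriv (γ t) (covDeriv (metric β) γ Y t)) = P := funext hcovP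
  have hd : HasWeakDerivAt (fun t => leftTriv (γ t) (covDeriv (metric β) γ Y t))
      (adj β (ξ t) (ζ t) + adj β (ζ t) (ξ t)
        - (1 / 2 : ℝ) • (⁅-symAdj β (ξ t) (ξ t), η t⁆ + ⁅ξ t, ζ t - ⁅ξ t, η t⁆⁆)
        + (symAdj β (-symAdj β (ξ t) (ξ t)) (η t) + symAdj β (ξ t) (ζ t - ⁅ξ t, η t⁆))) t := by
    rw [hcovP']; exact hPd t
  rw [leftTriv_add, leftTriv_covDeriv h (hγ.differentiable t) (hcovd t) hd, hcovP,
    leftTriv_curvature h (γ t) (Y t) (deriv γ t) (hYη' t) rfl]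
  have h0 : leftTriv (γ t) 0 = 0 := by simp [leftTriv_eq]
  have hJ := jacobi_algebra (β := β) h (ξ t) (η t) (ζ t) (adj β (ξ t) (ζ t) + adj β (ζ t) (ξ t))
  rw [sub_self] at hJ
  rw [h0, ← hJ]
  simp only [hξ, bodyVelocity, P]

theorem isConjugate_iff (h : IsTwoStep 𝔫) {γ : ℝ → 𝔫} (hγ : IsGeodesic (metric β) γ) (t : ℝ) :
    IsConjugate (metric β) γ t ↔
      ∃ η ζ, IsTrivJacobi β (bodyVelocity γ) η ζ ∧ (∃ s, η s ≠ 0) ∧ η 0 = 0 ∧ η t = 0 := by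
  have h0 : ∀ p : 𝔫, leftTriv p 0 = 0 := fun p => by simp [leftTriv_eq]
  constructor
  · rintro ⟨Y, hY, ⟨s, hs⟩, hY0, hYt⟩
    obtain ⟨ζ, hζ⟩ := IsTrivJacobi.of_isJacobiField h hγ hY
    refine ⟨_, ζ, hζ, ⟨s, fun hs0 => hs ?_⟩, by simp [hY0, h0], by simp [hYt, h0]⟩
    exact leftTriv_injective h (γ s) (hs0.trans (h0 _).symm)
  · rintro ⟨η, ζ, hη, ⟨s, hs⟩, hη0, hηt⟩
    refine ⟨_, hη.isJacobiField h hγ, ⟨s, fun hs0 => hs ?_⟩, by simp [hη0], by simp [hηt]⟩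
    rw [← leftTriv_add_lie h (γ s) (η s), hs0, h0]

end TwoStep

end

noncomputable section

/-! ### The linear system of Jacobi fields for a one-dimensional center -/

section LinearSystem

variable {V : Type*} [AddCommGroup V] [Module ℝ V]

/-- The Jacobi system for a one-dimensional center: `v` and `u` are the components of the field
orthogonal to the center and along it, and `w` and `s` those of the variation of the velocity. -/
structure IsJacobiSystem (b : LinearMap.BilinForm ℝ V) (J : Module.End ℝ V) (κ r : ℝ) (x : ℝ → V)
    (s : ℝ) (v w : ℝ → V) (u : ℝ → ℝ) : Prop where
  deriv_v : ∀ t, HasWeakDerivAt v (w t) t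
  deriv_w : ∀ t, HasWeakDerivAt w (s • J (x t) + r • J (w t)) t
  deriv_u : ∀ t, HasDerivAt u (κ * s - b (J (x t)) (v t)) t

/-- The Jacobi system has a nonzero solution that vanishes at `0` and at `t`. -/
def HasConjugateSolution (b : LinearMap.BilinForm ℝ V) (J : Module.End ℝ V) (κ r : ℝ) (x : ℝ → V)
    (t : ℝ) : Prop :=
  ∃ s v w u, IsJacobiSystem b J κ r x s v w u ∧ (∃ τ, v τ ≠ 0 ∨ u τ ≠ 0) ∧
    v 0 = 0 ∧ u 0 = 0 ∧ v t = 0 ∧ u t = 0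

theorem eq_of_hasWeakDerivAt {f g : ℝ → V} {f' : ℝ → V} (hf : ∀ t, HasWeakDerivAt f (f' t) t)
    (hg : ∀ t, HasWeakDerivAt g (f' t) t) (h0 : f 0 = g 0) (t : ℝ) : f t = g t := by
  have h : ∀ t, HasWeakDerivAt (fun s => f s - g s) 0 t := fun t => by
    simpa using (hf t).sub (hg t)
  have := HasWeakDerivAt.eq_of_deriv_eq_zero h t 0
  simpa [h0, sub_eq_zero] using this

theorem eq_of_hasDerivAt {f g : ℝ → ℝ} {f' : ℝ → ℝ} (hf : ∀ t, HasDerivAt f (f' t) t)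
    (hg : ∀ t, HasDerivAt g (f' t) t) (h0 : f 0 = g 0) (t : ℝ) : f t = g t :=
  eq_of_hasWeakDerivAt (fun t => hasDerivAt_iff_hasWeakDerivAt.1 (hf t))
    (fun t => hasDerivAt_iff_hasWeakDerivAt.1 (hg t)) h0 t

variable {b : LinearMap.BilinForm ℝ V} {J : Module.End ℝ V} {κ : ℝ}

/-- Here `v'' = s J x₀`, and vanishing at `0` and `t` forces `v = s (τ² - tτ)/2 • J x₀`. Integrating
`u'` from `0` to `t` produces the factor `t³/12`, since `∫ (τ² - tτ)/2 = -t³/12`. -/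
theorem hasConjugateSolution_const_iff {x₀ : V} (hJ : J x₀ ≠ 0) {t : ℝ} (ht : t ≠ 0) :
    HasConjugateSolution b J κ 0 (fun _ => x₀) t ↔ κ * t + t ^ 3 / 12 * b (J x₀) (J x₀) = 0 := by
  have hv : ∀ (s : ℝ) (τ : ℝ), HasWeakDerivAt (fun τ => (s * (τ ^ 2 - t * τ) / 2) • J x₀)
      ((s * (2 * τ - t) / 2) • J x₀) τ := fun s τ => by
    refine .smul_const ?_ _
    refine ((((hasDerivAt_pow 2 τ).sub ((hasDerivAt_id τ).const_mul t)).const_mul s).div_const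
      2).congr_deriv ?_
    simp
  have hw : ∀ (s : ℝ) (τ : ℝ), HasWeakDerivAt (fun τ => (s * (2 * τ - t) / 2) • J x₀)
      (s • J x₀) τ := fun s τ => by
    refine .smul_const ?_ _
    refine ((((hasDerivAt_id τ).const_mul 2).sub_const t).const_mul s |>.div_const
      2).congr_deriv ?_
    ring
  have hu : ∀ (s : ℝ) (τ : ℝ), HasDerivAt
      (fun τ => κ * s * τ - s * (τ ^ 3 / 3 - t * τ ^ 2 / 2) / 2 * b (J x₀) (J x₀))
      (κ * s - b (J x₀) ((s * (τ ^ 2 - t * τ) / 2) • J x₀)) τ := fun s τ => by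
    refine (((hasDerivAt_id τ).const_mul (κ * s)).sub
      ((((((hasDerivAt_pow 3 τ).div_const 3).sub
        (((hasDerivAt_pow 2 τ).const_mul t).div_const 2)).const_mul s).div_const 2).mul_const
        (b (J x₀) (J x₀)))).congr_deriv ?_
    rw [map_smul, smul_eq_mul]
    push_cast
    ring
  constructor
  · rintro ⟨s, v, w, u, h, ⟨τ₁, hne⟩, hv0, hu0, hvt, hut⟩
    have hw1 : ∀ τ, w τ = (w 0 + (s * t / 2) • J x₀) + (s * (2 * τ - t) / 2) • J x₀ :=
      eq_of_hasWeakDerivAt (f' := fun _ => s • J x₀) (fun τ => by simpa using h.deriv_w τ)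
        (fun τ => by simpa using (HasWeakDerivAt.const _ τ).add (hw s τ)) (by module)
    -- `k` is the linear coefficient of `v` beyond the quadratic solution vanishing at both ends; `v
    -- t = t • k` kills it.
    set k := w 0 + (s * t / 2) • J x₀ with hk
    have hv1 : ∀ τ, v τ = τ • k + (s * (τ ^ 2 - t * τ) / 2) • J x₀ :=
      eq_of_hasWeakDerivAt h.deriv_v (fun τ => by
        refine ((HasWeakDerivAt.smul_const (hasDerivAt_id τ) k).add (hv s τ)).congr_deriv ?_
        rw [hw1 τ, one_smul]) (by simp [hv0])
    have hk0 : k = 0 := by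
      have := hv1 t
      rw [hvt, show s * (t ^ 2 - t * t) / 2 = 0 by ring, zero_smul, add_zero] at this
      exact (smul_eq_zero.1 this.symm).resolve_left ht
    simp only [hk0, smul_zero, zero_add] at hv1
    have hu1 := eq_of_hasDerivAt (f := u) h.deriv_u (fun τ => by rw [hv1 τ]; exact hu s τ)
      (by simp [hu0])
    have hs : s ≠ 0 := by
      rintro rfl
      simp [hv1, hu1] at hne
    have := hu1 t
    rw [hut] at this
    refine (mul_eq_zero.1 (?_ : s * _ = 0)).resolve_left hs
    rw [this]
    ring
  · intro h
    -- The solution is seen to be nonzero at time `2t`, where `v = t² • J x₀`.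
    refine ⟨1, _, _, _, ⟨hv 1, fun τ => by simpa using hw 1 τ, hu 1⟩, ⟨2 * t, Or.inl ?_⟩,
      by simp, by simp, ?_, ?_⟩
    · rw [show 1 * ((2 * t) ^ 2 - t * (2 * t)) / 2 = t ^ 2 by ring]
      exact smul_ne_zero (pow_ne_zero 2 ht) hJ
    · rw [show 1 * (t ^ 2 - t * t) / 2 = 0 by ring, zero_smul]
    · rw [← h]
      ring

/-- `E` is the one-parameter group generated by `J`. -/
structure IsLinearFlow (J : Module.End ℝ V) (E : ℝ → Module.End ℝ V) : Prop where
  zero : E 0 = 1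
  deriv : ∀ x t, HasWeakDerivAt (fun τ => E τ x) (J (E t x)) t
  unique : ∀ y : ℝ → V, (∀ t, HasWeakDerivAt y (J (y t)) t) → ∀ t, y t = E t (y 0)

variable [FiniteDimensional ℝ V]

theorem form_eq_of_flow (hskew : ∀ x y, b (J x) y = -b x (J y)) {x y : ℝ → V}
    (hx : ∀ t, HasWeakDerivAt x (J (x t)) t) (hy : ∀ t, HasWeakDerivAt y (J (y t)) t) (t : ℝ) :
    b (x t) (y t) = b (x 0) (y 0) :=
  HasWeakDerivAt.eq_of_deriv_eq_zero (f := fun t => b (x t) (y t)) (fun t => by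
    simpa [hskew] using (hx t).bilin b (hy t)) t 0

/-- The system integrates explicitly, with parameters `s` and `h`. Skewness of `J` makes the flow an
isometry, so `⟨J x, E h⟩` is constant; this integrates `u` and simplifies its value at `t`. -/
theorem hasConjugateSolution_flow_iff (hsymm : ∀ x y, b x y = b y x)
    (hskew : ∀ x y, b (J x) y = -b x (J y)) (hJ : Function.Injective J)
    {E : ℝ → Module.End ℝ V} (hE : IsLinearFlow J E) {x : ℝ → V}
    (hx : ∀ t, HasWeakDerivAt x (J (x t)) t) (hx0 : x 0 ≠ 0) {t : ℝ} (ht : t ≠ 0) :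
    HasConjugateSolution b J κ 1 x t ↔
      ∃ (s : ℝ) (h : V), (s ≠ 0 ∨ h ≠ 0) ∧ E t h - h = -(s * t) • E t (x 0) ∧
        s * (κ + b (x 0) (x 0)) = b (J (x 0)) h := by
  have hJ0 : ∀ y, b (J y) y = 0 := fun y => by
    have := hskew y y
    rw [hsymm y (J y)] at this
    linarith
  have hJx : ∀ τ, HasWeakDerivAt (fun τ => J (x τ)) (J (J (x τ))) τ := fun τ => (hx τ).map J
  have hv : ∀ (s : ℝ) (h : V) (τ : ℝ), HasWeakDerivAt (fun τ => (s * τ) • x τ + (E τ h - h))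
      ((s * τ) • J (x τ) + s • x τ + J (E τ h)) τ := fun s h τ => by
    refine ((HasWeakDerivAt.smul ((hasDerivAt_id τ).const_mul s) (hx τ)).add
      ((hE.deriv h τ).sub (.const h τ))).congr_deriv ?_
    simp
  have hw : ∀ (s : ℝ) (h : V) (τ : ℝ), HasWeakDerivAt
      (fun τ => (s * τ) • J (x τ) + s • x τ + J (E τ h))
      (s • J (x τ) + J ((s * τ) • J (x τ) + s • x τ + J (E τ h))) τ := fun s h τ => by
    refine (((HasWeakDerivAt.smul ((hasDerivAt_id τ).const_mul s) (hJx τ)).add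
      ((hx τ).const_smul s)).add ((hE.deriv h τ).map J)).congr_deriv ?_
    simp only [id, mul_one, map_add, map_smul]
    module
  have hu : ∀ (s : ℝ) (h : V) (τ : ℝ), HasDerivAt
      (fun τ => κ * s * τ - τ * b (J (x 0)) h + b (x τ - x 0) h)
      (κ * s - b (J (x τ)) ((s * τ) • x τ + (E τ h - h))) τ := fun s h τ => by
    have hb : HasDerivAt (fun τ => b (x τ - x 0) h) (b (J (x τ)) h) τ := by
      simpa using ((hx τ).sub (.const (x 0) τ)) (b.flip h)
    refine ((((hasDerivAt_id τ).const_mul (κ * s)).sub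
      ((hasDerivAt_id τ).mul_const (b (J (x 0)) h))).add hb).congr_deriv ?_
    have := form_eq_of_flow hskew hJx (hE.deriv h) τ
    simp only [hE.zero, Module.End.one_apply] at this
    simp only [map_add, map_sub, map_smul, hJ0, this, smul_zero]
    ring
  have hend : ∀ (s : ℝ) (h : V), E t h - h = -(s * t) • E t (x 0) →
      κ * s * t - t * b (J (x 0)) h + b (x t - x 0) h
        = t * (s * (κ + b (x 0) (x 0)) - b (J (x 0)) h) := fun s h heq => by
    have h1 := form_eq_of_flow hskew hx (hE.deriv h) t
    have h2 := form_eq_of_flow hskew hx hx t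
    simp only [hE.zero, Module.End.one_apply] at h1
    rw [← hE.unique x hx t, sub_eq_iff_eq_add] at heq
    rw [heq, map_add, map_smul, h2, smul_eq_mul] at h1
    rw [map_sub, LinearMap.sub_apply, ← h1]
    ring
  constructor
  · rintro ⟨s, v, w, u, hs, ⟨τ₁, hne⟩, hv0, hu0, hvt, hut⟩
    -- `w - J v - s x` is a first integral, and it has the form `J h` because `J` is surjective.
    -- Then `v + h - sτ x` is a trajectory of `J`.
    obtain ⟨h, hh⟩ := (LinearMap.injective_iff_surjective.1 hJ) (w 0 - s • x 0)
    have hk : ∀ τ, w τ = J (v τ) + s • x τ + J h :=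
      eq_of_hasWeakDerivAt hs.deriv_w (fun τ => by
        refine ((((hs.deriv_v τ).map J).add ((hx τ).const_smul s)).add (.const (J h) τ)).congr_deriv
          ?_
        module) (by rw [hh, hv0, map_zero]; module)
    have hy : ∀ τ, HasWeakDerivAt (fun τ => v τ + h - (s * τ) • x τ)
        (J (v τ + h - (s * τ) • x τ)) τ := fun τ => by
      refine (((hs.deriv_v τ).add (.const h τ)).sub
        (HasWeakDerivAt.smul ((hasDerivAt_id τ).const_mul s) (hx τ))).congr_deriv ?_
      rw [hk τ]
      simp only [id, mul_one, map_add, map_sub, map_smul]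
      module
    have hv1 : ∀ τ, v τ = (s * τ) • x τ + (E τ h - h) := fun τ => by
      have := hE.unique _ hy τ
      simp only [hv0, zero_add, mul_zero, zero_smul, sub_zero] at this
      rw [← this]
      module
    have hu1 := eq_of_hasDerivAt (f := u) hs.deriv_u (fun τ => by rw [hv1 τ]; exact hu s h τ)
      (by simp [hu0])
    have heq : E t h - h = -(s * t) • E t (x 0) := by
      have := hv1 t
      rw [hvt, hE.unique x hx t] at this
      rw [neg_smul, eq_neg_iff_add_eq_zero, this, add_comm]
    refine ⟨s, h, ?_, heq, ?_⟩
    · by_contra! hsh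
      obtain ⟨rfl, rfl⟩ := hsh
      simp [hv1, hu1] at hne
    · have := hu1 t
      rw [hut, hend s h heq] at this
      exact sub_eq_zero.1 ((mul_eq_zero.1 this.symm).resolve_left ht)
  · rintro ⟨s, h, hne, heq, hform⟩
    refine ⟨s, _, _, _, ⟨hv s h, fun τ => by simpa only [one_smul] using hw s h τ, hu s h⟩, ?_,
      by simp [hE.zero], by simp, ?_, ?_⟩
    -- If `v` vanishes identically, so does `w`; its value and derivative at `0` give `s J x₀ = 0`,
    -- hence `s = 0`, and then `J h = 0`.
    · by_contra! hcon
      have hv0 : (fun τ => (s * τ) • x τ + (E τ h - h)) = fun _ => 0 := funext fun τ => (hcon τ).1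
      have hw0 : (fun τ => (s * τ) • J (x τ) + s • x τ + J (E τ h)) = fun _ => 0 :=
        funext fun τ => (hv s h τ).unique (by rw [hv0]; exact .const 0 τ)
      have hw0' : HasWeakDerivAt (fun τ => (s * τ) • J (x τ) + s • x τ + J (E τ h)) 0 0 := by
        rw [hw0]
        exact .const 0 0
      have h1 := (hw s h 0).unique hw0'
      have h2 := congrFun hw0 0
      simp only [mul_zero, zero_smul, zero_add, hE.zero, Module.End.one_apply] at h1 h2
      rw [h2, map_zero, add_zero] at h1
      have hs : s = 0 := by
        by_contra hs
        have := (smul_eq_zero.1 h1).resolve_left hs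
        exact hx0 (hJ (this.trans (map_zero J).symm))
      rw [hs, zero_smul, zero_add] at h2
      exact hne.elim (· hs) (· (hJ (h2.trans (map_zero J).symm)))
    · rw [heq, ← hE.unique x hx t]
      module
    · rw [hend s h heq, hform, sub_self, mul_zero]

end LinearSystem

end

noncomputable section

/-! ### The flow of an operator whose square is diagonalizable -/

section SpectralFlow

/-- The square of a skew operator is self-adjoint. -/
theorem form_eq_zero_of_sq_eigenvector {V : Type*} [AddCommGroup V] [Module ℝ V]
    {b : LinearMap.BilinForm ℝ V} {J : Module.End ℝ V} (hskew : ∀ x y, b (J x) y = -b x (J y))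
    {y z : V} {μ ν : ℝ} (hμν : μ ≠ ν)
    (hy : J (J y) = μ • y) (hz : J (J z) = ν • z) : b y z = 0 := by
  have h1 : b (J (J y)) z = b y (J (J z)) := by rw [hskew, hskew, neg_neg]
  rw [hy, hz, map_smul, map_smul, LinearMap.smul_apply, smul_eq_mul, smul_eq_mul, ← sub_eq_zero,
    ← sub_mul] at h1
  exact (mul_eq_zero.1 h1).resolve_left (sub_ne_zero.2 hμν)

variable {V : Type*} [AddCommGroup V] [Module ℝ V] {ι : Type*} [DecidableEq ι]

theorem exists_projections [Fintype ι] {W : ι → Submodule ℝ V} (hW : DirectSum.IsInternal W) :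
    ∃ P : ι → Module.End ℝ V, (∀ i x, P i x ∈ W i) ∧ (∀ x, ∑ i, P i x = x) ∧
      (∀ i, ∀ x ∈ W i, P i x = x) ∧ ∀ i j, i ≠ j → ∀ x ∈ W j, P i x = 0 := by
  let e := LinearEquiv.ofBijective (DirectSum.coeLinearMap W) hW
  have he : ∀ i (x : W i), e.symm (x : V) = DirectSum.lof ℝ ι (fun i => W i) i x := fun i x => by
    rw [LinearEquiv.symm_apply_eq]
    exact (DirectSum.coeLinearMap_lof W i x).symm
  refine ⟨fun i => (W i).subtype ∘ₗ DirectSum.component ℝ ι (fun i => W i) i ∘ₗ e.symm,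
    fun i x => (DirectSum.component ℝ ι (fun i => W i) i (e.symm x)).2, fun x => ?_,
    fun i x hx => ?_, fun i j hij x hx => ?_⟩
  · classical
    conv_rhs => rw [← e.apply_symm_apply x]
    change _ = DirectSum.coeLinearMap W (e.symm x)
    rw [DirectSum.coeLinearMap_eq_dfinsuppSum, DFinsupp.sum_eq_sum_fintype _ (by simp)]
    rfl
  · have := he i ⟨x, hx⟩
    simp only at this
    simp [this, DirectSum.component.lof_self]
  · have := he j ⟨x, hx⟩
    simp only at this
    simp [this, DirectSum.component.of, hij.symm]

variable {J : Module.End ℝ V} {μ : ι → ℝ} {W : ι → Submodule ℝ V} {c sn : ι → ℝ → ℝ}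

/-- The operator `J` preserves the summands `W i`, its square is the scalar `μ i` there, and `c i`
and `sn i` are the even and odd fundamental solutions of `f'' = μ i f`. -/
structure IsSpectralData (J : Module.End ℝ V) (μ : ι → ℝ) (W : ι → Submodule ℝ V)
    (c sn : ι → ℝ → ℝ) : Prop where
  internal : DirectSum.IsInternal W
  sq : ∀ i, ∀ x ∈ W i, J (J x) = μ i • x
  invariant : ∀ i, ∀ x ∈ W i, J x ∈ W i
  c_zero : ∀ i, c i 0 = 1
  sn_zero : ∀ i, sn i 0 = 0
  deriv_c : ∀ i t, HasDerivAt (c i) (μ i * sn i t) t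
  deriv_sn : ∀ i t, HasDerivAt (sn i) (c i t) t

namespace IsSpectralData

/-- The conserved energy of `f'' = μ f`, covering both `cos² + sin² = 1` and `cosh² - sinh² = 1`. -/
theorem sq_sub (h : IsSpectralData J μ W c sn) (i : ι) (t : ℝ) :
    c i t ^ 2 - μ i * sn i t ^ 2 = 1 := by
  have hd : ∀ t, HasDerivAt (fun t => c i t ^ 2 - μ i * sn i t ^ 2) 0 t := fun t => by
    refine (((h.deriv_c i t).pow 2).sub (((h.deriv_sn i t).pow 2).const_mul (μ i))).congr_deriv ?_
    push_cast
    ring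
  have := eq_of_hasDerivAt hd (fun t => hasDerivAt_const t 1) (by simp [h.c_zero, h.sn_zero]) t
  exact this

/-- On each summand `J² = μ`, so `exp(tJ)` is `c + sn J`, assembled by the projections, which
commute with `J`. -/
theorem exists_isLinearFlow [Fintype ι] (h : IsSpectralData J μ W c sn) :
    ∃ E : ℝ → Module.End ℝ V, IsLinearFlow J E ∧
      ∀ i, ∀ x ∈ W i, ∀ t, E t x = c i t • x + sn i t • J x := by
  obtain ⟨P, hPmem, hPsum, hPself, hPne⟩ := exists_projections h.internal
  have hPJ : ∀ i x, P i (J x) = J (P i x) := fun i x => by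
    conv_lhs => rw [← hPsum x]
    rw [map_sum, map_sum, Finset.sum_eq_single i (fun j _ hj =>
      hPne i j hj.symm _ (h.invariant j _ (hPmem j x))) (by simp),
      hPself i _ (h.invariant i _ (hPmem i x))]
  let E : ℝ → Module.End ℝ V := fun t => ∑ i, (c i t • P i + sn i t • J ∘ₗ P i)
  have hE : ∀ t x, E t x = ∑ i, (c i t • P i x + sn i t • J (P i x)) := fun t x => by
    simp [E, LinearMap.sum_apply]
  refine ⟨E, ⟨LinearMap.ext fun x => ?_, fun x t => ?_, fun y hy t => ?_⟩, fun i x hx t => ?_⟩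
  · simp [hE, h.c_zero, h.sn_zero, hPsum]
  · simp only [hE]
    refine (HasWeakDerivAt.sum fun i _ => (HasWeakDerivAt.smul_const (h.deriv_c i t) (P i x)).add
      (HasWeakDerivAt.smul_const (h.deriv_sn i t) (J (P i x)))).congr_deriv ?_
    rw [map_sum]
    refine Finset.sum_congr rfl fun i _ => ?_
    rw [map_add, map_smul, map_smul, h.sq i _ (hPmem i x)]
    module
  · rw [hE, ← hPsum (y t)]
    refine Finset.sum_congr rfl fun i _ => ?_
    -- The integrating factor `exp(-tJ) = c - sn J` makes the component of the trajectory constant;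
    -- `sq_sub` then inverts it.
    have hd : ∀ t, HasWeakDerivAt (fun t => c i t • P i (y t) - sn i t • J (P i (y t))) 0 t :=
      fun t => by
        refine ((HasWeakDerivAt.smul (h.deriv_c i t) ((hy t).map (P i))).sub
          (HasWeakDerivAt.smul (h.deriv_sn i t) (((hy t).map (P i)).map J))).congr_deriv ?_
        rw [hPJ, h.sq i _ (hPmem i _)]
        module
    have h1 : c i t • P i (y t) - sn i t • J (P i (y t)) = P i (y 0) := by
      simpa [h.c_zero, h.sn_zero] using HasWeakDerivAt.eq_of_deriv_eq_zero hd t 0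
    rw [← h1, map_sub, map_smul, map_smul, h.sq i _ (hPmem i _)]
    calc P i (y t) = (c i t ^ 2 - μ i * sn i t ^ 2) • P i (y t) := by rw [h.sq_sub, one_smul]
      _ = _ := by module
  · rw [hE, Finset.sum_eq_single i (fun j _ hj => by simp [hPne j i hj x hx]) (by simp),
      hPself i x hx]

/-- On `W i` the operator `E t - 1` has norm `(1 - c)² - μ sn² = 2 (1 - c)`, so the dichotomy is
whether some `c i t` equals `1`. If so, the fixed vectors of `E t` give solutions with `s = 0`; if
not, `h` is determined by `s`. -/
theorem hasConjugateSolution_iff [Fintype ι] [FiniteDimensional ℝ V] {b : LinearMap.BilinForm ℝ V} {κ : ℝ}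
    (h : IsSpectralData J μ W c sn) (hμ : Function.Injective μ)
    (hsymm : ∀ x y, b x y = b y x) (hskew : ∀ x y, b (J x) y = -b x (J y))
    (hJ : Function.Injective J) (hW : ∀ i, ∃ x ∈ W i, x ≠ 0) {x : ℝ → V}
    (hx : ∀ t, HasWeakDerivAt x (J (x t)) t) (hx0 : x 0 ≠ 0) {A : ι → V} (hA : ∀ i, A i ∈ W i)
    (hxA : x 0 = ∑ i, A i) {t : ℝ} (ht : t ≠ 0) (hneg : ∀ i, c i t = 1 → μ i < 0) :
    HasConjugateSolution b J κ 1 x t ↔ (∃ i, c i t = 1) ∨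
      ∑ i, b (A i) (A i) * (t * (-(μ i * sn i t) / (2 * (1 - c i t)))) = κ + b (x 0) (x 0) := by
  obtain ⟨E, hE, hEW⟩ := h.exists_isLinearFlow
  rw [hasConjugateSolution_flow_iff hsymm hskew hJ hE hx hx0 ht]
  by_cases hc : ∃ i, c i t = 1
  · simp only [hc, true_or, iff_true]
    obtain ⟨i, hi⟩ := hc
    obtain ⟨y, hy, hy0⟩ := hW i
    have hsn : sn i t = 0 := by
      have := h.sq_sub i t
      rw [hi, one_pow, sub_eq_self] at this
      exact pow_eq_zero_iff two_ne_zero |>.1 ((mul_eq_zero.1 this).resolve_left (hneg i hi).ne)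
    have hfix : ∀ z ∈ W i, E t z = z := fun z hz => by simp [hEW i z hz, hi, hsn]
    suffices ∃ z ∈ W i, z ≠ 0 ∧ b (J (x 0)) z = 0 by
      obtain ⟨z, hz, hz0, hbz⟩ := this
      exact ⟨0, z, Or.inr hz0, by simp [hfix z hz], by simp [hbz]⟩
    by_cases hby : b (J (x 0)) y = 0
    · exact ⟨y, hy, hy0, hby⟩
    -- This combination of `y` and `J y` is orthogonal to `J (x 0)`. It is nonzero, since otherwise
    -- `J` would have a real eigenvector in `W i`, where its square is negative.
    · refine ⟨b (J (x 0)) (J y) • y - b (J (x 0)) y • J y, (W i).sub_mem ((W i).smul_mem _ hy)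
        ((W i).smul_mem _ (h.invariant i y hy)), fun h0 => ?_, by simp [mul_comm]⟩
      set p := b (J (x 0)) (J y)
      set q := b (J (x 0)) y
      have h1 : q • J y = p • y := (sub_eq_zero.1 h0).symm
      have h2 : (q ^ 2 * μ i) • y = p ^ 2 • y := by
        calc (q ^ 2 * μ i) • y = q • J (q • J y) := by
              rw [map_smul, h.sq i y hy]; module
          _ = p ^ 2 • y := by
              rw [h1, map_smul, smul_comm, h1]; module
      have h3 := smul_left_injective ℝ hy0 h2
      have h4 : q ^ 2 * μ i < 0 := mul_neg_of_pos_of_neg (by positivity) (hneg i hi)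
      nlinarith [sq_nonneg p]
  · simp only [hc, false_or]
    push Not at hc
    have hc' : ∀ i, 1 - c i t ≠ 0 := fun i => sub_ne_zero.2 (hc i).symm
    set ρ : ι → ℝ := fun i => sn i t / (2 * (1 - c i t)) with hρ
    -- `R = (E t - 1)⁻¹ E t (x 0)`: on `W i` the operator `E (E - 1)⁻¹ = 1/2 + (E + 1)(E - 1)⁻¹ / 2`
    -- equals `1/2 - sn J / (2 (1 - c))`.
    set R : V := (1 / 2 : ℝ) • x 0 - ∑ i, ρ i • J (A i) with hR
    have hER : E t R - R = E t (x 0) := by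
      have hRsum : R = ∑ i, ((1 / 2 : ℝ) • A i - ρ i • J (A i)) := by
        rw [hR, hxA, Finset.smul_sum, Finset.sum_sub_distrib]
      rw [hRsum, hxA, map_sum, map_sum, ← Finset.sum_sub_distrib]
      refine Finset.sum_congr rfl fun i _ => ?_
      rw [map_sub, map_smul, map_smul, hEW i _ (hA i), hEW i _ (h.invariant i _ (hA i)),
        h.sq i _ (hA i)]
      have e1 : ρ i * (1 - c i t) = sn i t / 2 := by
        simp only [hρ]; field_simp [hc' i]
      have e2 : ρ i * sn i t * μ i = -(1 + c i t) / 2 := by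
        have : (1 - c i t) * (ρ i * sn i t * μ i) = (1 - c i t) * (-(1 + c i t) / 2) := by
          linear_combination sn i t * μ i * e1 - (1 / 2) * h.sq_sub i t
        exact mul_left_cancel₀ (hc' i) this
      have e3 : ((1 / 2 : ℝ) * c i t - 1 / 2 - ρ i * sn i t * μ i) • A i
          + (sn i t / 2 + ρ i * (1 - c i t)) • J (A i) = c i t • A i + sn i t • J (A i) := by
        rw [e1, e2]; module
      refine Eq.trans ?_ e3
      module
    have hinj : ∀ z, E t z = z → z = 0 := fun z hz => by
      obtain ⟨P, hPmem, hPsum, hPself, hPne⟩ := exists_projections h.internal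
      have hdet : ∀ i, ∀ y ∈ W i, E t y = y → y = 0 := fun i y hy hEy => by
        have e1 : (1 - c i t) • y = sn i t • J y := by
          rw [hEW i y hy] at hEy
          rw [sub_smul, one_smul, sub_eq_iff_eq_add, add_comm]
          exact hEy.symm
        have e2 : (1 - c i t) • J y = (sn i t * μ i) • y := by
          rw [← map_smul, e1, map_smul, h.sq i y hy, smul_smul]
        have e3 : (1 - c i t) • ((1 - c i t) • y) = (sn i t ^ 2 * μ i) • y := by
          rw [e1, smul_comm, e2]; module
        have e4 : (2 * (1 - c i t)) • y = 0 := by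
          rw [show 2 * (1 - c i t) = (1 - c i t) * (1 - c i t) - sn i t ^ 2 * μ i by
            linear_combination -h.sq_sub i t, sub_smul, mul_smul, e3, sub_self]
        exact (smul_eq_zero.1 e4).resolve_left (mul_ne_zero two_ne_zero (hc' i))
      have hmem : ∀ i, ∀ y ∈ W i, E t y ∈ W i := fun i y hy => by
        rw [hEW i y hy]
        exact (W i).add_mem ((W i).smul_mem _ hy) ((W i).smul_mem _ (h.invariant i y hy))
      rw [← hPsum z]
      refine Finset.sum_eq_zero fun i _ => hdet i _ (hPmem i z) ?_
      have : P i (E t z) = E t (P i z) := by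
        conv_lhs => rw [← hPsum z]
        rw [map_sum, map_sum, Finset.sum_eq_single i (fun j _ hj =>
          hPne i j hj.symm _ (hmem j _ (hPmem j z))) (by simp), hPself i _ (hmem i _ (hPmem i z))]
      rw [← this, hz]
    have horth : ∀ i j, i ≠ j → ∀ y ∈ W i, ∀ z ∈ W j, b y z = 0 := fun i j hij y hy z hz =>
      form_eq_zero_of_sq_eigenvector hskew (hμ.ne hij) (h.sq i y hy) (h.sq j z hz)
    have hbR : b (J (x 0)) R = ∑ i, b (A i) (A i) * (μ i * ρ i) := by
      have h0 : b (J (x 0)) (x 0) = 0 := by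
        have := hskew (x 0) (x 0)
        rw [hsymm (x 0) (J (x 0))] at this
        linarith
      have hcross : ∀ i, b (J (x 0)) (J (A i)) = -(μ i * b (A i) (A i)) := fun i => by
        rw [hskew, h.sq i _ (hA i), map_smul, smul_eq_mul, hxA, map_sum, LinearMap.sum_apply,
          Finset.sum_eq_single i (fun j _ hj => horth j i hj _ (hA j) _ (hA i)) (by simp)]
      rw [hR, map_sub, map_smul, h0, smul_zero, zero_sub, map_sum, ← Finset.sum_neg_distrib]
      refine Finset.sum_congr rfl fun i _ => ?_
      rw [map_smul, hcross, smul_eq_mul]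
      ring
    have hsum : ∑ i, b (A i) (A i) * (t * (-(μ i * sn i t) / (2 * (1 - c i t))))
        = -t * b (J (x 0)) R := by
      rw [hbR, Finset.mul_sum]
      refine Finset.sum_congr rfl fun i _ => ?_
      simp only [hρ]
      ring
    rw [hsum]
    constructor
    · rintro ⟨s, y, hne, hy, hs⟩
      have hyR : y = -(s * t) • R := by
        refine sub_eq_zero.1 (hinj _ ?_)
        rw [← sub_eq_zero, map_sub, map_smul]
        have : E t y - -(s * t) • E t R - (y - -(s * t) • R)
            = (E t y - y) - -(s * t) • (E t R - R) := by module
        rw [this, hy, hER, sub_self]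
      have hs0 : s ≠ 0 := by
        rintro rfl
        simp [hyR] at hne
      rw [hyR, map_smul, smul_eq_mul] at hs
      refine mul_left_cancel₀ hs0 ?_
      rw [hs]
      ring
    · intro heq
      refine ⟨1, -t • R, Or.inl one_ne_zero, ?_, ?_⟩
      · rw [map_smul, ← smul_sub, hER, one_mul]
      · rw [← heq, map_smul, smul_eq_mul, one_mul]

end IsSpectralData

end SpectralFlow

end

noncomputable section

/-! ### Reduction to the orthogonal complement of a one-dimensional center -/

namespace TwoStep

open PseudoRiem

variable {𝔫 : Type*} [LieRing 𝔫] [LieAlgebra ℝ 𝔫]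

/-- The vector `e` spans the center and is not null. -/
structure IsCentralGenerator (β : InnerForm 𝔫) (e : 𝔫) : Prop where
  mem : e ∈ cent 𝔫
  span : ∀ y ∈ cent 𝔫, ∃ c : ℝ, y = c • e
  ne_zero : β.form e e ≠ 0

variable {β : InnerForm 𝔫}

theorem isCentralGenerator (hcent : (β.form.restrict (cent 𝔫)).Nondegenerate)
    (hdim : Module.finrank ℝ (cent 𝔫) = 1) {z : cent 𝔫} (hz : z ≠ 0) :
    IsCentralGenerator β z := by
  have hspan : ∀ y : cent 𝔫, ∃ c : ℝ, c • z = y := (finrank_eq_one_iff_of_nonzero' z hz).1 hdim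
  refine ⟨z.2, fun y hy => ?_, fun h0 => hz (hcent.1 z fun y => ?_)⟩
  · obtain ⟨c, hc⟩ := hspan ⟨y, hy⟩
    exact ⟨c, by rw [← Submodule.coe_smul, hc]⟩
  · obtain ⟨c, rfl⟩ := hspan y
    rw [map_smul]
    exact smul_eq_zero_of_right c h0

namespace IsCentralGenerator

variable {e : 𝔫}

theorem lie_right (he : IsCentralGenerator β e) (x : 𝔫) : ⁅x, e⁆ = 0 :=
  (LieModule.mem_maxTrivSubmodule ℝ 𝔫 𝔫 e).1 he.mem x

theorem form_vee (he : IsCentralGenerator β e) (x : vee β) : β.form e x = 0 := x.2 e he.mem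

/-- The projection to the orthogonal complement of the center. -/
def proj (he : IsCentralGenerator β e) : 𝔫 →ₗ[ℝ] vee β where
  toFun x := ⟨x - (β.form e x / β.form e e) • e, fun y hy => by
    obtain ⟨c, rfl⟩ := he.span y hy
    have := he.ne_zero
    simp [this]⟩
  map_add' x y := Subtype.ext <| by simp only [map_add, add_div, Submodule.coe_add]; module
  map_smul' c x := Subtype.ext <| by
    simp only [map_smul, smul_eq_mul, mul_div_assoc, RingHom.id_apply, Submodule.coe_smul]; module

theorem proj_add (he : IsCentralGenerator β e) (x : 𝔫) :
    (he.proj x : 𝔫) + (β.form e x / β.form e e) • e = x := sub_add_cancel _ _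

theorem proj_self (he : IsCentralGenerator β e) : he.proj e = 0 :=
  Subtype.ext <| by simp [proj, div_self he.ne_zero]

theorem proj_vee (he : IsCentralGenerator β e) (x : vee β) : he.proj (x : 𝔫) = x :=
  Subtype.ext <| by simp [proj, he.form_vee]

theorem form_proj (he : IsCentralGenerator β e) (v : vee β) (x : 𝔫) :
    β.form v (he.proj x) = β.form v x := by
  conv_rhs => rw [← he.proj_add x]
  rw [map_add, map_smul, form_comm (v : 𝔫) e, he.form_vee, smul_zero, add_zero]

theorem lie_eq (h : IsTwoStep 𝔫) (he : IsCentralGenerator β e) (x y : 𝔫) :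
    ⁅x, y⁆ = (β.form e ⁅x, y⁆ / β.form e e) • e := by
  obtain ⟨c, hc⟩ := he.span _ (h x y)
  rw [hc, map_smul, smul_eq_mul, mul_div_cancel_right₀ _ he.ne_zero]

theorem lie_proj_left (he : IsCentralGenerator β e) (x y : 𝔫) : ⁅(he.proj x : 𝔫), y⁆ = ⁅x, y⁆ := by
  conv_rhs => rw [← he.proj_add x]
  rw [add_lie, smul_lie, ← lie_skew e y, he.lie_right, neg_zero, smul_zero, add_zero]

variable [FiniteDimensional ℝ 𝔫]

theorem form_J (x y : vee β) : β.form (J β e x) y = β.form e ⁅(x : 𝔫), (y : 𝔫)⁆ :=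
  form_adDagger β x e y

theorem form_lie (he : IsCentralGenerator β e) (x y : 𝔫) :
    β.form e ⁅x, y⁆ = β.form (J β e (he.proj x)) (he.proj y) := by
  rw [form_proj, ← he.lie_proj_left]
  exact (form_adDagger β (he.proj x) e y).symm

/-- Brackets lie on the line of `e` and ignore central parts, so only the central component of `z`
and the orthogonal component of `x` matter. -/
theorem adj_eq (h : IsTwoStep 𝔫) (he : IsCentralGenerator β e) (x z : 𝔫) :
    adj β x z = (β.form e z / β.form e e) • (J β e (he.proj x) : 𝔫) :=
  eq_of_form_eq β fun y => by
    rw [form_adj, he.lie_eq h, map_smul, map_smul, LinearMap.smul_apply, ← form_proj he _ y,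
      ← he.form_lie, form_comm z e]
    simp only [smul_eq_mul]
    ring

theorem J_skew (x y : vee β) : β.form (J β e x) y = -β.form x (J β e y) := by
  rw [form_J, form_comm (x : 𝔫), form_J, ← lie_skew, map_neg]

/-- A vector killed by `J_e` brackets trivially with everything, hence is central; but it is also
orthogonal to the non-null generator of the center. -/
theorem J_injective (h : IsTwoStep 𝔫) (he : IsCentralGenerator β e) :
    Function.Injective (J β e) := by
  rw [← LinearMap.ker_eq_bot, LinearMap.ker_eq_bot']
  intro x hx
  have hc : (x : 𝔫) ∈ cent 𝔫 := by
    refine (LieModule.mem_maxTrivSubmodule ℝ 𝔫 𝔫 (x : 𝔫)).2 fun y => ?_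
    rw [← lie_skew, he.lie_eq h, he.form_lie, he.proj_vee, hx]
    simp
  obtain ⟨c, hc⟩ := he.span _ hc
  have h0 := he.form_vee x
  rw [hc, map_smul, smul_eq_mul] at h0
  refine Subtype.ext ?_
  rw [hc, (mul_eq_zero.1 h0).resolve_right he.ne_zero, zero_smul, Submodule.coe_zero]

/-- The adjoint terms are orthogonal to the center, so the central coefficient of `ζ` is a constant
`s`; brackets are central, so they drop out of the equation for the orthogonal part of `η`. -/
theorem isTrivJacobi_iff (h : IsTwoStep 𝔫) (he : IsCentralGenerator β e) {ξ : ℝ → 𝔫} {r : ℝ}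
    (hξ : ∀ t, β.form e (ξ t) = r * β.form e e) (t : ℝ) :
    (∃ η ζ, IsTrivJacobi β ξ η ζ ∧ (∃ s, η s ≠ 0) ∧ η 0 = 0 ∧ η t = 0) ↔
      HasConjugateSolution (β.form.restrict (vee β)) (J β e) (β.form e e) r
        (fun t => he.proj (ξ t)) t := by
  have hκ := he.ne_zero
  have hr : ∀ t, β.form e (ξ t) / β.form e e = r := fun t => by rw [hξ, mul_div_cancel_right₀ _ hκ]
  constructor
  · rintro ⟨η, ζ, hs, ⟨τ, hτ⟩, h0, ht⟩
    have hζ : ∀ t, HasWeakDerivAt (fun t => β.form e (ζ t)) 0 t := fun t => by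
      refine ((hs.deriv_velocity t).map (β.form e)).congr_deriv ?_
      simp [he.adj_eq h, he.form_vee]
    have hs1 : ∀ t, β.form e (ζ t) = β.form e e * (β.form e (ζ 0) / β.form e e) := fun t => by
      rw [HasWeakDerivAt.eq_of_deriv_eq_zero hζ t 0, mul_div_cancel₀ _ hκ]
    refine ⟨β.form e (ζ 0) / β.form e e, fun t => he.proj (η t), fun t => he.proj (ζ t),
      fun t => β.form e (η t), ⟨fun t => ?_, fun t => ?_, fun t => ?_⟩, ⟨τ, ?_⟩, by simp [h0],
      by simp [h0], by simp [ht], by simp [ht]⟩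
    · refine ((hs.deriv_field t).map he.proj).congr_deriv ?_
      rw [map_sub, he.lie_eq h, map_smul, he.proj_self, smul_zero, sub_zero]
    · refine ((hs.deriv_velocity t).map he.proj).congr_deriv ?_
      rw [he.adj_eq h, he.adj_eq h, hr, hs1, mul_div_cancel_left₀ _ hκ, map_add, map_smul, map_smul,
        he.proj_vee, he.proj_vee]
    · refine HasDerivAt.congr_deriv (hs.deriv_field t (β.form e)) ?_
      rw [map_sub, hs1, he.form_lie]
      rfl
    · by_contra! hcon
      refine hτ ?_
      rw [← he.proj_add (η τ), hcon.1, hcon.2]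
      simp
  · rintro ⟨s, v, w, u, hs, ⟨τ, hτ⟩, hv0, hu0, hvt, hut⟩
    have hproj : ∀ (v : vee β) (c : ℝ), he.proj ((v : 𝔫) + c • e) = v := fun v c => by
      rw [map_add, map_smul, he.proj_self, smul_zero, add_zero, he.proj_vee]
    -- `u` is a pairing with `e`, so the coefficient along `e` is `u / ⟨e, e⟩`.
    refine ⟨fun t => (v t : 𝔫) + (u t / β.form e e) • e, fun t => (w t : 𝔫) + s • e,
      ⟨fun t => ?_, fun t => ?_⟩, ⟨τ, fun hcon => ?_⟩, by simp [hv0, hu0], by simp [hvt, hut]⟩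
    · refine (((hs.deriv_v t).map (vee β).subtype).add
        (.smul_const ((hs.deriv_u t).div_const _) e)).congr_deriv ?_
      rw [he.lie_eq h (ξ t), he.form_lie, hproj, sub_div, mul_div_cancel_left₀ _ hκ, sub_smul,
        Submodule.subtype_apply, LinearMap.BilinForm.restrict_apply]
      abel
    · refine (((hs.deriv_w t).map (vee β).subtype).add (.const (s • e) t)).congr_deriv ?_
      rw [he.adj_eq h, he.adj_eq h, hr, hproj, map_add (β.form e), he.form_vee, zero_add, map_smul,
        smul_eq_mul, mul_div_cancel_right₀ _ hκ, add_zero]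
      rfl
    · have h1 := congrArg he.proj hcon
      have h2 := congrArg (β.form e) hcon
      rw [hproj, map_zero] at h1
      beta_reduce at h2
      rw [map_add, map_smul, smul_eq_mul, div_mul_cancel₀ _ hκ, map_zero, he.form_vee,
        zero_add] at h2
      exact hτ.elim (· h1) (· h2)

variable [TopologicalSpace 𝔫] [IsTopologicalAddGroup 𝔫] [ContinuousSMul ℝ 𝔫] [T2Space 𝔫]

theorem form_bodyVelocity (h : IsTwoStep 𝔫) (he : IsCentralGenerator β e) {γ : ℝ → 𝔫}
    (hγ : IsGeodesic (metric β) γ) (t : ℝ) :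
    β.form e (bodyVelocity γ t) = β.form e (bodyVelocity γ 0) :=
  HasWeakDerivAt.eq_of_deriv_eq_zero (f := fun t => β.form e (bodyVelocity γ t)) (fun t => by
    refine ((hasWeakDerivAt_bodyVelocity h hγ t).map (β.form e)).congr_deriv ?_
    simp [symAdj_apply, he.adj_eq h, he.form_vee]) t 0

theorem hasWeakDerivAt_proj_bodyVelocity (h : IsTwoStep 𝔫) (he : IsCentralGenerator β e)
    {γ : ℝ → 𝔫} (hγ : IsGeodesic (metric β) γ) (t : ℝ) :
    HasWeakDerivAt (fun t => he.proj (bodyVelocity γ t))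
      ((β.form e (bodyVelocity γ t) / β.form e e) • J β e (he.proj (bodyVelocity γ t))) t := by
  refine ((hasWeakDerivAt_bodyVelocity h hγ t).map he.proj).congr_deriv ?_
  rw [symAdj_apply, he.adj_eq h, map_neg, map_smul, map_add, map_smul, he.proj_vee]
  module

theorem isConjugate_iff_hasConjugateSolution (h : IsTwoStep 𝔫) (he : IsCentralGenerator β e)
    {γ : ℝ → 𝔫} (hγ : IsGeodesic (metric β) γ) {r : ℝ}
    (hr : β.form e (bodyVelocity γ 0) = r * β.form e e) (t : ℝ) :
    IsConjugate (metric β) γ t ↔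
      HasConjugateSolution (β.form.restrict (vee β)) (J β e) (β.form e e) r
        (fun t => he.proj (bodyVelocity γ t)) t := by
  rw [isConjugate_iff h hγ, he.isTrivJacobi_iff h
    (fun t => (he.form_bodyVelocity h hγ t).trans hr)]

end IsCentralGenerator

end TwoStep

end

noncomputable section

/-! ### Spectral data of a diagonalizable square -/

section Spectral

variable {V : Type*} [AddCommGroup V] [Module ℝ V]

/-- The eigenvalues listed by `a` and `b`. -/
def signedSquares {q r : ℕ} (a : Fin q → ℝ) (b : Fin r → ℝ) : Fin q ⊕ Fin r → ℝ :=
  Sum.elim (fun k => -(a k) ^ 2) (fun l => (b l) ^ 2)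

variable {T : Module.End ℝ V} {q r : ℕ} {a : Fin q → ℝ} {b : Fin r → ℝ}

theorem eigenFamily_eq (T : Module.End ℝ V) (a : Fin q → ℝ) (b : Fin r → ℝ) :
    eigenFamily T a b = fun i => T.eigenspace (signedSquares a b i) :=
  funext fun i => by cases i <;> rfl

theorem EigenvalueList.signedSquares_injective (h : EigenvalueList T a b) :
    Function.Injective (signedSquares a b) := by
  have h1 : ∀ k l, -(a k) ^ 2 ≠ (b l) ^ 2 := fun k l => by
    have := h.a_pos k
    have := h.b_pos l
    have : -(a k) ^ 2 < (b l) ^ 2 := by nlinarith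
    exact this.ne
  rintro (k | l) (k' | l') hkl
  · exact congrArg _ (h.a_inj ((sq_eq_sq₀ (h.a_pos k).le (h.a_pos k').le).1 (neg_inj.1 hkl)))
  · exact absurd hkl (h1 k l')
  · exact absurd hkl.symm (h1 k' l)
  · exact congrArg _ (h.b_inj ((sq_eq_sq₀ (h.b_pos l).le (h.b_pos l').le).1 hkl))

theorem EigenvalueList.hasEigenvalue_iff (h : EigenvalueList T a b) (μ : ℝ) :
    T.HasEigenvalue μ ↔ ∃ i, μ = signedSquares a b i := by
  rw [h.eigenvalue_iff, Sum.exists]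
  rfl

theorem EigenvalueList.isInternal (h : EigenvalueList T a b) (hT : IsRealDiagonalizable T) :
    DirectSum.IsInternal (eigenFamily T a b) := by
  rw [eigenFamily_eq]
  refine DirectSum.isInternal_submodule_of_iSupIndep_of_iSup_eq_top
    (T.eigenspaces_iSupIndep.comp h.signedSquares_injective) (eq_top_iff.2 ?_)
  obtain ⟨v, hv⟩ := hT
  rw [← v.span_eq, Submodule.span_le]
  rintro _ ⟨i, rfl⟩
  obtain ⟨μ, hμ⟩ := hv i
  have hmem : v i ∈ T.eigenspace μ := Module.End.mem_eigenspace_iff.2 hμ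
  obtain ⟨j, rfl⟩ := (h.hasEigenvalue_iff μ).1
    (Module.End.hasEigenvalue_of_hasEigenvector ⟨hmem, v.ne_zero i⟩)
  exact Submodule.mem_iSup_of_mem j hmem

/-- The finite spectrum is split by sign; injectivity excludes `0`, and `a`, `b` are the square
roots of the absolute values. -/
theorem exists_eigenvalueList [FiniteDimensional ℝ V] (hT : Function.Injective T) :
    ∃ (q r : ℕ) (a : Fin q → ℝ) (b : Fin r → ℝ), EigenvalueList T a b := by
  classical
  have hfin : {μ | T.HasEigenvalue μ}.Finite := T.finite_hasEigenvalue
  have h0 : ¬ T.HasEigenvalue 0 := fun h => by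
    obtain ⟨v, hv⟩ := h.exists_hasEigenvector
    exact hv.2 (hT (by rw [hv.apply_eq_smul, zero_smul, map_zero]))
  let N := hfin.toFinset.filter (· < 0)
  let P := hfin.toFinset.filter (0 < ·)
  have hN : ∀ k : N, T.HasEigenvalue (k : ℝ) ∧ (k : ℝ) < 0 := fun k => by
    have := Finset.mem_filter.1 k.2
    exact ⟨hfin.mem_toFinset.1 this.1, this.2⟩
  have hP : ∀ k : P, T.HasEigenvalue (k : ℝ) ∧ 0 < (k : ℝ) := fun k => by
    have := Finset.mem_filter.1 k.2
    exact ⟨hfin.mem_toFinset.1 this.1, this.2⟩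
  have hNsq : ∀ k : N, √(-(k : ℝ)) ^ 2 = -k := fun k => Real.sq_sqrt (by linarith [(hN k).2])
  have hPsq : ∀ k : P, √(k : ℝ) ^ 2 = k := fun k => Real.sq_sqrt (hP k).2.le
  refine ⟨N.card, P.card, fun k => √(-(N.equivFin.symm k : ℝ)), fun l => √(P.equivFin.symm l : ℝ),
    fun k => Real.sqrt_pos.2 (by linarith [(hN (N.equivFin.symm k)).2]),
    fun l => Real.sqrt_pos.2 (hP _).2, fun k k' hkk => ?_, fun l l' hll => ?_, fun μ => ?_⟩
  · have := congrArg (· ^ 2) hkk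
    simp only [hNsq, neg_inj] at this
    exact N.equivFin.symm.injective (Subtype.ext this)
  · have := congrArg (· ^ 2) hll
    simp only [hPsq] at this
    exact P.equivFin.symm.injective (Subtype.ext this)
  · simp only [hNsq, hPsq, neg_neg]
    constructor
    · intro h
      rcases lt_trichotomy μ 0 with hμ | rfl | hμ
      · exact Or.inl ⟨N.equivFin ⟨μ, by simp [N, h, hμ]⟩, by simp⟩
      · exact absurd h h0
      · exact Or.inr ⟨P.equivFin ⟨μ, by simp [P, h, hμ]⟩, by simp⟩
    · rintro (⟨k, rfl⟩ | ⟨l, rfl⟩)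
      · exact (hN _).1
      · exact (hP _).1

theorem EigenComponents.mem {x : V} {A : Fin q → V} {B : Fin r → V}
    (h : EigenComponents T a b x A B) (i : Fin q ⊕ Fin r) :
    Sum.elim A B i ∈ eigenFamily T a b i := by
  cases i
  · exact h.A_mem _
  · exact h.B_mem _

theorem EigenComponents.eq_sum {x : V} {A : Fin q → V} {B : Fin r → V}
    (h : EigenComponents T a b x A B) : x = ∑ i, Sum.elim A B i := by
  rw [h.sum_eq, Fintype.sum_sum_type]
  rfl

variable {J : Module.End ℝ V}

theorem apply_apply_of_mem_eigenFamily {i : Fin q ⊕ Fin r} {x : V}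
    (hx : x ∈ eigenFamily (J ^ 2) a b i) : J (J x) = signedSquares a b i • x := by
  rw [eigenFamily_eq] at hx
  simpa [pow_two] using Module.End.mem_eigenspace_iff.1 hx

theorem apply_mem_eigenFamily {i : Fin q ⊕ Fin r} {x : V}
    (hx : x ∈ eigenFamily (J ^ 2) a b i) : J x ∈ eigenFamily (J ^ 2) a b i := by
  have := apply_apply_of_mem_eigenFamily hx
  rw [eigenFamily_eq, Module.End.mem_eigenspace_iff, pow_two, Module.End.mul_apply, this, map_smul]

theorem EigenvalueList.isSpectralData (h : EigenvalueList (J ^ 2) a b)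
    (hT : IsRealDiagonalizable (J ^ 2)) :
    IsSpectralData J (signedSquares a b) (eigenFamily (J ^ 2) a b)
      (Sum.elim (fun k t => Real.cos (a k * t)) (fun l t => Real.cosh (b l * t)))
      (Sum.elim (fun k t => Real.sin (a k * t) / a k) (fun l t => Real.sinh (b l * t) / b l)) where
  internal := h.isInternal hT
  sq _ _ hx := apply_apply_of_mem_eigenFamily hx
  invariant _ _ hx := apply_mem_eigenFamily hx
  c_zero i := by cases i <;> simp
  sn_zero i := by cases i <;> simp
  deriv_c i t := by
    rcases i with k | l
    · have := (h.a_pos k).ne'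
      refine ((hasDerivAt_id t).const_mul (a k)).cos.congr_deriv ?_
      simp only [signedSquares, Sum.elim_inl, id]
      field_simp
    · have := (h.b_pos l).ne'
      refine ((hasDerivAt_id t).const_mul (b l)).cosh.congr_deriv ?_
      simp only [signedSquares, Sum.elim_inr, id]
      field_simp
  deriv_sn i t := by
    rcases i with k | l
    · have := (h.a_pos k).ne'
      refine (((hasDerivAt_id t).const_mul (a k)).sin.div_const (a k)).congr_deriv ?_
      simp only [Sum.elim_inl, id]
      field_simp
    · have := (h.b_pos l).ne'
      refine (((hasDerivAt_id t).const_mul (b l)).sinh.div_const (b l)).congr_deriv ?_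
      simp only [Sum.elim_inr, id]
      field_simp

theorem half_cot_eq {α : ℝ} (hα : α ≠ 0) (t : ℝ) :
    t * (-(-α ^ 2 * (Real.sin (α * t) / α)) / (2 * (1 - Real.cos (α * t))))
      = α * t / 2 * Real.cot (α * t / 2) := by
  set x := α * t / 2 with hx
  have h1 : α * t = 2 * x := by rw [hx]; ring
  rw [h1, Real.sin_two_mul, Real.cos_two_mul, Real.cot_eq_cos_div_sin]
  -- At a pole of the cotangent both sides are `0` by the convention for division by zero.
  by_cases hs : Real.sin x = 0
  · simp [hs]
  · have h2 : 2 * (1 - (2 * Real.cos x ^ 2 - 1)) = 4 * Real.sin x ^ 2 := by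
      rw [Real.cos_sq']; ring
    rw [h2, show x = α * t / 2 from hx]
    field_simp
    ring

theorem half_coth_eq {α : ℝ} (hα : α ≠ 0) (t : ℝ) :
    t * (-(α ^ 2 * (Real.sinh (α * t) / α)) / (2 * (1 - Real.cosh (α * t))))
      = α * t / 2 * realCoth (α * t / 2) := by
  set x := α * t / 2 with hx
  have h1 : α * t = 2 * x := by rw [hx]; ring
  rw [h1, Real.sinh_two_mul, Real.cosh_two_mul, realCoth]
  by_cases hs : Real.sinh x = 0
  · simp [hs]
  · have h2 : 2 * (1 - (Real.cosh x ^ 2 + Real.sinh x ^ 2)) = -(4 * Real.sinh x ^ 2) := by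
      rw [Real.cosh_sq']; ring
    rw [h2, show x = α * t / 2 from hx]
    field_simp
    ring

end Spectral

end

noncomputable section

/-! ### Conjugate points -/

namespace TwoStep

open PseudoRiem

variable {𝔫 : Type*} [LieRing 𝔫] [LieAlgebra ℝ 𝔫] [FiniteDimensional ℝ 𝔫] {β : InnerForm 𝔫} {e : 𝔫}
  {q r : ℕ} {a : Fin q → ℝ} {b : Fin r → ℝ}

theorem form_eigenFamily_eq_zero (h : EigenvalueList (J β e ^ 2) a b) {i j : Fin q ⊕ Fin r}
    (hij : i ≠ j) {x y : vee β} (hx : x ∈ eigenFamily (J β e ^ 2) a b i)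
    (hy : y ∈ eigenFamily (J β e ^ 2) a b j) : β.form x y = 0 :=
  form_eq_zero_of_sq_eigenvector (b := β.form.restrict (vee β)) IsCentralGenerator.J_skew
    (h.signedSquares_injective.ne hij) (apply_apply_of_mem_eigenFamily hx)
    (apply_apply_of_mem_eigenFamily hy)

/-- By skewness `⟨J x, J x⟩ = -⟨x, J² x⟩`, and the eigenspaces are orthogonal. -/
theorem form_J_J (h : EigenvalueList (J β e ^ 2) a b) {x : vee β} {A : Fin q → vee β}
    {B : Fin r → vee β} (hx : EigenComponents (J β e ^ 2) a b x A B) :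
    β.form (J β e x) (J β e x)
      = ∑ k, a k ^ 2 * β.form (A k) (A k) - ∑ l, b l ^ 2 * β.form (B l) (B l) := by
  have hsum : β.form (J β e x) (J β e x)
      = ∑ i, -(signedSquares a b i * β.form (Sum.elim A B i : vee β) (Sum.elim A B i : vee β)) := by
    rw [IsCentralGenerator.J_skew]
    conv_lhs => rw [hx.eq_sum]
    simp only [map_sum, AddSubmonoidClass.coe_finsetSum, ← Finset.sum_neg_distrib]
    refine Finset.sum_congr rfl fun i _ => ?_
    rw [apply_apply_of_mem_eigenFamily (hx.mem i), LinearMap.sum_apply, Finset.sum_eq_single i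
      (fun j _ hj => ?_) (by simp)]
    · simp
    · rw [Submodule.coe_smul, map_smul, form_eigenFamily_eq_zero h hj (hx.mem j) (hx.mem i),
        smul_zero]
  rw [hsum, Fintype.sum_sum_type]
  simp [signedSquares, sub_eq_add_neg]

variable [TopologicalSpace 𝔫] [IsTopologicalAddGroup 𝔫] [ContinuousSMul ℝ 𝔫] [T2Space 𝔫]

omit [FiniteDimensional ℝ 𝔫] in
theorem bodyVelocity_zero {γ : ℝ → 𝔫} (hγ : γ 0 = 0) : bodyVelocity γ 0 = deriv γ 0 := by
  simp [bodyVelocity, hγ, leftTriv_eq]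

/-- Conjugate points along a geodesic whose initial velocity is orthogonal to the center. -/
theorem isConjugate_iff_of_orthogonal (h2 : IsTwoStep 𝔫) (he : IsCentralGenerator β e)
    (hunit : β.form e e = 1 ∨ β.form e e = -1) {γ : ℝ → 𝔫} (hγ : IsGeodesic (metric β) γ)
    (hγ0 : γ 0 = 0) {x₀ : vee β} (hx₀ : x₀ ≠ 0) (hγ' : deriv γ 0 = (x₀ : 𝔫))
    (h : EigenvalueList (J β e ^ 2) a b) {A : Fin q → vee β} {B : Fin r → vee β}
    (hx : EigenComponents (J β e ^ 2) a b x₀ A B) {t : ℝ} (ht : t ≠ 0) :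
    IsConjugate (metric β) γ t ↔
      12 / t ^ 2 = ∑ l, b l ^ 2 * β.form e e * β.form (B l) (B l)
        - ∑ k, a k ^ 2 * β.form e e * β.form (A k) (A k) := by
  have h0 : bodyVelocity γ 0 = x₀ := (bodyVelocity_zero hγ0).trans hγ'
  -- The conserved central component is zero, so the orthogonal component of the velocity has zero
  -- derivative.
  have hconst : (fun t => he.proj (bodyVelocity γ t)) = fun _ => x₀ := funext fun t => by
    have := HasWeakDerivAt.eq_of_deriv_eq_zero (fun t => by
      simpa [he.form_bodyVelocity h2 hγ t, h0, he.form_vee] using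
        he.hasWeakDerivAt_proj_bodyVelocity h2 hγ t) t 0
    rw [this, h0, he.proj_vee]
  have hJ : J β e x₀ ≠ 0 := fun h0 => hx₀ (he.J_injective h2 (h0.trans (map_zero _).symm))
  rw [he.isConjugate_iff_hasConjugateSolution h2 hγ (r := 0) (by simp [h0, he.form_vee]), hconst,
    hasConjugateSolution_const_iff hJ ht, LinearMap.BilinForm.restrict_apply]
  change _ * t + t ^ 3 / 12 * β.form (J β e x₀) (J β e x₀) = 0 ↔ _
  have hrhs : ∑ l, b l ^ 2 * β.form e e * β.form (B l) (B l)
        - ∑ k, a k ^ 2 * β.form e e * β.form (A k) (A k)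
      = -(β.form e e * β.form (J β e x₀) (J β e x₀)) := by
    rw [form_J_J h hx, mul_sub, neg_sub, Finset.mul_sum, Finset.mul_sum]
    congr 1 <;> exact Finset.sum_congr rfl fun _ _ => by ring
  rw [hrhs, div_eq_iff (pow_ne_zero 2 ht)]
  generalize β.form (J β e x₀) (J β e x₀) = m
  -- For a unit generator, multiplication by `⟨e, e⟩` is invertible and moves the sign from the
  -- linear term to the cubic one.
  have hκ : β.form e e * β.form e e = 1 := by rcases hunit with h | h <;> rw [h] <;> norm_num
  constructor
  · intro heq
    refine mul_left_cancel₀ ht ?_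
    linear_combination 12 * β.form e e * heq - 12 * t * hκ
  · intro heq
    linear_combination (β.form e e * t / 12) * heq - t ^ 3 / 12 * m * hκ

/-- Conjugate points along a geodesic whose initial velocity has central component `e`. -/
theorem isConjugate_iff_of_central_ne_zero (h2 : IsTwoStep 𝔫) (he : IsCentralGenerator β e)
    (hdiag : IsRealDiagonalizable (J β e ^ 2)) {γ : ℝ → 𝔫} (hγ : IsGeodesic (metric β) γ)
    (hγ0 : γ 0 = 0) {x₀ : vee β} (hx₀ : x₀ ≠ 0) (hγ' : deriv γ 0 = e + (x₀ : 𝔫))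
    (h : EigenvalueList (J β e ^ 2) a b) {A : Fin q → vee β} {B : Fin r → vee β}
    (hx : EigenComponents (J β e ^ 2) a b x₀ A B) {t : ℝ} (ht : t ≠ 0) :
    IsConjugate (metric β) γ t ↔
      (∃ (k : Fin q) (n : ℤ), n ≠ 0 ∧ t = 2 * Real.pi / a k * n) ∨
      ∑ k, β.form (A k) (A k) * (a k * t / 2 * Real.cot (a k * t / 2))
        + ∑ l, β.form (B l) (B l) * (b l * t / 2 * realCoth (b l * t / 2))
        = metric β (γ t) (deriv γ t) (deriv γ t) := by
  have hκ := he.ne_zero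
  have h0 : bodyVelocity γ 0 = e + x₀ := (bodyVelocity_zero hγ0).trans hγ'
  have hp0 : he.proj (bodyVelocity γ 0) = x₀ := by rw [h0, map_add, he.proj_self, he.proj_vee, zero_add]
  have hcoef : ∀ t, β.form e (bodyVelocity γ t) = β.form e e := fun t => by
    rw [he.form_bodyVelocity h2 hγ t, h0, map_add, he.form_vee, add_zero]
  have hxd : ∀ t, HasWeakDerivAt (fun t => he.proj (bodyVelocity γ t))
      (J β e (he.proj (bodyVelocity γ t))) t := fun t => by
    simpa [hcoef, hκ] using he.hasWeakDerivAt_proj_bodyVelocity h2 hγ t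
  have hskew : ∀ x y : vee β, β.form.restrict (vee β) (J β e x) y
      = -β.form.restrict (vee β) x (J β e y) := IsCentralGenerator.J_skew
  -- The energy splits orthogonally; its central part is constant, and the flow of the skew operator
  -- `J` preserves the other part.
  have henergy : metric β (γ t) (deriv γ t) (deriv γ t)
      = β.form e e + β.form.restrict (vee β) x₀ x₀ := by
    have h1 := form_eq_of_flow hskew hxd hxd t
    rw [hp0] at h1
    rw [← h1]
    have hdec := he.proj_add (bodyVelocity γ t)
    rw [hcoef, div_self hκ, one_smul] at hdec
    change β.form (bodyVelocity γ t) (bodyVelocity γ t)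
      = _ + β.form (he.proj (bodyVelocity γ t) : 𝔫) (he.proj (bodyVelocity γ t) : 𝔫)
    generalize he.proj (bodyVelocity γ t) = v at hdec
    rw [← hdec]
    simp only [map_add, LinearMap.add_apply, he.form_vee, form_comm (v : 𝔫) e]
    ring
  have hW : ∀ i, ∃ x ∈ eigenFamily (J β e ^ 2) a b i, x ≠ 0 := fun i => by
    obtain ⟨x, hx⟩ := ((h.hasEigenvalue_iff _).2 ⟨i, rfl⟩).exists_hasEigenvector
    exact ⟨x, by rw [eigenFamily_eq]; exact hx.1, hx.2⟩
  rw [he.isConjugate_iff_hasConjugateSolution h2 hγ (r := 1) (by rw [hcoef, one_mul]),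
    (h.isSpectralData hdiag).hasConjugateSolution_iff h.signedSquares_injective
      (fun x y => form_comm (x : 𝔫) y) hskew (he.J_injective h2) hW hxd (by rwa [hp0]) hx.mem
      (hp0.trans hx.eq_sum) ht ?_, hp0, henergy, Fintype.sum_sum_type]
  · refine or_congr ?_ (Eq.congr (congrArg₂ _ ?_ ?_) rfl)
    · rw [Sum.exists]
      -- Hyperbolic blocks never fix a vector at `t ≠ 0`, so only the condition `cos (a k * t) = 1`
      -- survives; there `n ≠ 0` because `t ≠ 0`.
      have hcosh : ∀ l, Real.cosh (b l * t) ≠ 1 := fun l =>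
        (Real.one_lt_cosh.2 (mul_ne_zero (h.b_pos l).ne' ht)).ne'
      simp only [Sum.elim_inl, Sum.elim_inr, hcosh, exists_false, or_false]
      refine exists_congr fun k => ?_
      have hk := (h.a_pos k).ne'
      rw [Real.cos_eq_one_iff]
      refine exists_congr fun n => ⟨fun hn => ⟨?_, ?_⟩, fun hn => ?_⟩
      · rintro rfl
        simp [hk, ht] at hn
      · field_simp
        linarith
      · rw [hn.2]
        field_simp
    · exact Finset.sum_congr rfl fun k _ => congrArg _ (half_cot_eq (h.a_pos k).ne' t)
    · exact Finset.sum_congr rfl fun l _ => congrArg _ (half_coth_eq (h.b_pos l).ne' t)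
  · rintro (k | l) hi
    · exact neg_neg_of_pos (pow_pos (h.a_pos k) 2)
    · exact absurd hi (Real.one_lt_cosh.2 (mul_ne_zero (h.b_pos l).ne' ht)).ne'

end TwoStep

end

theorem corollary8 {𝔫 : Type*} [LieRing 𝔫] [LieAlgebra ℝ 𝔫] [FiniteDimensional ℝ 𝔫]
    [TopologicalSpace 𝔫] [IsTopologicalAddGroup 𝔫] [ContinuousSMul ℝ 𝔫] [T2Space 𝔫]
    (h2 : TwoStep.IsTwoStep 𝔫)
    (β : InnerForm 𝔫)
    (hcent : (β.form.restrict (TwoStep.cent 𝔫)).Nondegenerate)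
    (hdim : Module.finrank ℝ (TwoStep.cent 𝔫) = 1)
    (hdiag : ∀ z : TwoStep.cent 𝔫, IsRealDiagonalizable (TwoStep.J β z ^ 2)) :
    -- the decomposition of the orthogonal complement of the center
    (∀ z : TwoStep.cent 𝔫, z ≠ 0 →
      ∃ (q r : ℕ) (a : Fin q → ℝ) (b : Fin r → ℝ),
        EigenvalueList (TwoStep.J β z ^ 2) a b ∧
        DirectSum.IsInternal (eigenFamily (TwoStep.J β z ^ 2) a b) ∧
        (∀ i j, i ≠ j → ∀ x : TwoStep.vee β, x ∈ eigenFamily (TwoStep.J β z ^ 2) a b i →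
          ∀ y : TwoStep.vee β, y ∈ eigenFamily (TwoStep.J β z ^ 2) a b j → β.form x y = 0) ∧
        (∀ i, ∀ x : TwoStep.vee β, x ∈ eigenFamily (TwoStep.J β z ^ 2) a b i →
          TwoStep.J β z x ∈ eigenFamily (TwoStep.J β z ^ 2) a b i)) ∧
    -- geodesics with initial velocity orthogonal to the center
    (∀ (x₀ : TwoStep.vee β), x₀ ≠ 0 →
      ∀ γ : ℝ → 𝔫, PseudoRiem.IsGeodesic (TwoStep.metric β) γ → γ 0 = 0 →
      deriv γ 0 = (x₀ : 𝔫) →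
      ∀ z : TwoStep.cent 𝔫, (β.form z z = 1 ∨ β.form z z = -1) →
      ∀ (q r : ℕ) (a : Fin q → ℝ) (b : Fin r → ℝ),
      EigenvalueList (TwoStep.J β z ^ 2) a b →
      ∀ (A : Fin q → TwoStep.vee β) (B : Fin r → TwoStep.vee β),
      EigenComponents (TwoStep.J β z ^ 2) a b x₀ A B →
      ∀ t : ℝ, t ≠ 0 →
        (PseudoRiem.IsConjugate (TwoStep.metric β) γ t ↔
          12 / t ^ 2 = ∑ l, (b l) ^ 2 * β.form z z * β.form (B l) (B l)
            - ∑ k, (a k) ^ 2 * β.form z z * β.form (A k) (A k))) ∧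
    -- geodesics with both components of the initial velocity nonzero
    (∀ (z₀ : TwoStep.cent 𝔫) (x₀ : TwoStep.vee β), z₀ ≠ 0 → x₀ ≠ 0 →
      ∀ γ : ℝ → 𝔫, PseudoRiem.IsGeodesic (TwoStep.metric β) γ → γ 0 = 0 →
      deriv γ 0 = (z₀ : 𝔫) + (x₀ : 𝔫) →
      ∀ (q r : ℕ) (a : Fin q → ℝ) (b : Fin r → ℝ),
      EigenvalueList (TwoStep.J β z₀ ^ 2) a b →
      ∀ (A : Fin q → TwoStep.vee β) (B : Fin r → TwoStep.vee β),
      EigenComponents (TwoStep.J β z₀ ^ 2) a b x₀ A B →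
      ∀ t : ℝ, t ≠ 0 →
        (PseudoRiem.IsConjugate (TwoStep.metric β) γ t ↔
          (∃ (k : Fin q) (n : ℤ), n ≠ 0 ∧ t = 2 * Real.pi / a k * n) ∨
          ∑ k, β.form (A k) (A k) * (a k * t / 2 * Real.cot (a k * t / 2))
            + ∑ l, β.form (B l) (B l) * (b l * t / 2 * realCoth (b l * t / 2))
            = TwoStep.metric β (γ t) (deriv γ t) (deriv γ t))) := by
  refine ⟨fun z hz => ?_, fun x₀ hx₀ γ hγ hγ0 hγ' z hz q r a b h A B hx t ht => ?_,
    fun z₀ x₀ hz₀ hx₀ γ hγ hγ0 hγ' q r a b h A B hx t ht => ?_⟩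
  · have he := TwoStep.isCentralGenerator hcent hdim hz
    have hinj : Function.Injective ⇑(TwoStep.J β z ^ 2) := by
      rw [pow_two]
      exact (he.J_injective h2).comp (he.J_injective h2)
    obtain ⟨q, r, a, b, h⟩ := exists_eigenvalueList hinj
    exact ⟨q, r, a, b, h, h.isInternal (hdiag z),
      fun i j hij x hx y hy => TwoStep.form_eigenFamily_eq_zero h hij hx hy,
      fun i x hx => apply_mem_eigenFamily hx⟩
  · have hz0 : z ≠ 0 := by
      rintro rfl
      simp at hz
    exact TwoStep.isConjugate_iff_of_orthogonal h2 (TwoStep.isCentralGenerator hcent hdim hz0) hz hγ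
      hγ0 hx₀ hγ' h hx ht
  · exact TwoStep.isConjugate_iff_of_central_ne_zero h2 (TwoStep.isCentralGenerator hcent hdim hz₀)
      (hdiag z₀) hγ hγ0 hx₀ hγ' h hx ht
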